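/- Let $G$ be a locally compact (Hausdorff) group with left Haar measure $m_G$, let $M(G)$ be the space of regular complex Borel measures on $G$ with the total variation norm $\|\cdot\|_1$ and the weak$^*$ topology $\sigma(M(G),C_0(G))$, and let $\mu*\nu$ be the convolution of $\mu,\nu\in M(G)$, i.e. the element of $M(G)$ with $\int f\,d(\mu*\nu)=\int\int f(xy)\,d\nu(y)\,d\mu(x)$ for all $f\in C_0(G)$. Powers of measures are convolution powers, with $\mu^0=\delta_e$, the Dirac measure at the unit element $e$ of $G$. For $\mu\in M(G)$ and $f\in L^p(G)=L^p(G,m_G)$ with $1<p<\infty$, put $\mu*f=\int_G \pi(g)f\,d\mu(g)\in L^p(G)$ (a Bochner integral), where $(\pi(g)f)(s)=f(g^{-1}s)$. Corollary 3.2. If $\mu\in M(G)$ is power bounded, that is, $\sup_{n\ge 0}\|\mu^n\|_1<\infty$, then there exists an idempotent measure $\theta\in M(G)$ (that is, $\theta*\theta=\theta$) such that $$\lim_{n\to\infty}\left(\frac{\delta_e+\mu}{2}\right)^n=\theta\quad\text{in the weak}^*\text{ topology of }M(G).$$ Moreover, for the same $\theta$, for every $1<p<\infty$ and every $f\in L^p(G)$,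 $$\lim_{n\to\infty}\left[\left(\frac{\delta_e+\mu}{2}\right)^n*f\right]=\theta*f\quad\text{in }L^p\text{-norm.}$$ -/

import Mathlib

open MeasureTheory Filter Topology
open scoped ENNReal ZeroAtInfty

noncomputable section

namespace MeasAlg

section Integral

variable {X E : Type*} [MeasurableSpace X]
  [NormedAddCommGroup E] [NormedSpace ℝ E] [NormedSpace ℂ E] [IsScalarTower ℝ ℂ E]

/-- The (Bochner) integral `∫ f dμ` of a function with values in a complex Banach space `E` against
a complex measure `μ`; the pairing is `(v, c) ↦ c • v`, so that `∫ 1_A v dμ = μ(A) • v`. -/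
def cintegral (μ : ComplexMeasure X) (f : X → E) : E :=
  μ.integral f (ContinuousLinearMap.lsmul ℝ ℂ).flip

end Integral

section Group

variable {G : Type*} [TopologicalSpace G] [MeasurableSpace G]

/-- `μ ∈ M(G)`: a complex Borel measure `μ` is regular if its total variation measure `|μ|` is
regular (total variations of complex measures are automatically finite). -/
def IsRegular (μ : ComplexMeasure G) : Prop :=
  μ.variation.Regular

/-- The total variation norm `‖μ‖₁ = |μ|(G)`. -/
def tvNorm (μ : ComplexMeasure G) : ℝ≥0∞ :=
  μ.variation Set.univ

/-- Convergence of the sequence `μ n` to `θ` in the topology `σ(M(G), C₀(G))`. -/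
def WeakStarTendsto (μ : ℕ → ComplexMeasure G) (θ : ComplexMeasure G) : Prop :=
  ∀ f : C₀(G, ℂ), Tendsto (fun n ↦ cintegral (μ n) f) atTop (𝓝 (cintegral θ f))

variable [Group G]

/-- `ρ` is the convolution of `μ` and `ν`: it is the regular complex measure with
`∫ f dρ = ∫ ∫ f(xy) dν(y) dμ(x)` for all `f ∈ C₀(G)`. -/
def IsConv (μ ν ρ : ComplexMeasure G) : Prop :=
  IsRegular ρ ∧
    ∀ f : C₀(G, ℂ), cintegral ρ f = cintegral μ fun x ↦ cintegral ν fun y ↦ f (x * y)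

open Classical in
/-- The convolution `μ * ν` of complex measures on a locally compact group. For regular `μ`, `ν`
the measure described by `IsConv` exists and is unique by the Riesz representation theorem, so that
the value `0` in the other branch is never used on `M(G)`. -/
def conv (μ ν : ComplexMeasure G) : ComplexMeasure G :=
  if h : ∃ ρ, IsConv μ ν ρ then h.choose else 0

/-- The Dirac measure `δ_e` at the unit element, as a complex measure. -/
def deltaOne (G : Type*) [MeasurableSpace G] [Group G] : ComplexMeasure G :=
  VectorMeasure.dirac (1 : G) (1 : ℂ)

/-- Convolution powers, with `μ⁰ = δ_e`. -/
def convPow (μ : ComplexMeasure G) : ℕ → ComplexMeasure G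
  | 0 => deltaOne G
  | n + 1 => conv μ (convPow μ n)

/-- `μ` is power bounded: `sup_{n ≥ 0} ‖μⁿ‖₁ < ∞`. -/
def PowerBounded (μ : ComplexMeasure G) : Prop :=
  ⨆ n : ℕ, tvNorm (convPow μ n) < ∞

variable [IsTopologicalGroup G] [BorelSpace G]

/-- The left regular representation of `G` on `L^p(G)`: `(π(g) f)(s) = f(g⁻¹ s)`. -/
def leftTranslate {m : Measure G} [m.IsMulLeftInvariant] {p : ℝ≥0∞} (g : G) (f : Lp ℂ p m) :
    Lp ℂ p m :=
  Lp.compMeasurePreserving (fun s ↦ g⁻¹ * s) (measurePreserving_mul_left m g⁻¹) f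

/-- The convolution `μ * f = ∫ π(g) f dμ(g)` of a measure `μ` and `f ∈ L^p(G)`, where the integral
is the Bochner integral in `L^p(G)` and `π` is the left regular representation. -/
def convLp {m : Measure G} [m.IsMulLeftInvariant] {p : ℝ≥0∞} [Fact (1 ≤ p)]
    (μ : ComplexMeasure G) (f : Lp ℂ p m) : Lp ℂ p m :=
  cintegral μ fun g ↦ leftTranslate g f

end Group

end MeasAlg

end

/-! Write ν = (δ_e + μ)/2. A regular measure ρ acts on C₀(G) by f ↦ (x ↦ ∫ f(xy) dρ(y)); this
operator, `convLeft`, is multiplicative and additive in ρ and determines ρ, since evaluation at the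
unit returns ∫ f dρ. Questions about convolution powers thus become questions about powers of the
operators S of μ and T = (1 + S)/2 of ν.

The analytic input is that T^n(1 - T) → 0 in norm (`tendsto_half_smul_pow_mul`). T^n is a binomial
average of powers of S, hence bounded, and T^n(1 - T) is a combination of powers of S whose
coefficients have absolute sum at most 1/√(n+1), by the variance of the binomial distribution.

Bounded sets of measures are weak* compact, so ν^n has a limit θ along every ultrafilter
(`exists_ultrafilter_limit`). Convolution by a fixed regular measure, on either side, is weak*
continuous because its pre-adjoint preserves C₀(G). With ν^n - ν^(n+1) → 0 this gives ν*θ = θ*ν = θ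
for each limit along a free ultrafilter. If θ and θ' are two such limits, passing to the limit in
ν^n*θ' = θ' and in θ*ν^n = θ yields θ' = θ*θ' = θ. The limit is therefore unique and idempotent, and
ν^n converges to it.

For 1 < p < ∞ the coefficients x ↦ φ(π(x)f) of the regular representation vanish at infinity
(`tendsto_leftTranslate`), so weak* convergence of ν^n gives weak convergence of ν^n*f to θ*f. As in
the mean ergodic theorem, f - θ*f then lies in the closed range of 1 - T, now for T acting on L^p,
and T^n(1 - T) → 0 makes the convergence strong (`tendsto_pow_of_weak`). -/

noncomputable section

namespace MeasAlg

/-! ### Jordan decomposition and total variation of complex measures -/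

section Variation

variable {X : Type*} [MeasurableSpace X]

/-- A finite positive measure, seen as a complex measure. -/
def ofMeasure (p : Measure X) [IsFiniteMeasure p] : ComplexMeasure X :=
  SignedMeasure.toComplexMeasure p.toSignedMeasure 0

lemma ofMeasure_apply (p : Measure X) [IsFiniteMeasure p] {s : Set X} (hs : MeasurableSet s) :
    ofMeasure p s = (p.real s : ℂ) := by
  apply Complex.ext <;>
    simp [ofMeasure, SignedMeasure.toComplexMeasure_apply,
      Measure.toSignedMeasure_apply_measurable hs]

lemma variation_ofMeasure_le (p : Measure X) [IsFiniteMeasure p] :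
    (ofMeasure p).variation ≤ p := by
  refine VectorMeasure.variation_le_of_forall_enorm_le fun s hs ↦ ?_
  rw [ofMeasure_apply p hs, ← ofReal_norm, Complex.norm_real, Real.norm_of_nonneg (by positivity),
    ofReal_measureReal]

/-- The Jordan pieces of a complex measure: positive and negative parts of its real part, then of
its imaginary part. -/
def jordanPart (μ : ComplexMeasure X) : Fin 4 → Measure X :=
  ![(ComplexMeasure.re μ).toJordanDecomposition.posPart,
    (ComplexMeasure.re μ).toJordanDecomposition.negPart,
    (ComplexMeasure.im μ).toJordanDecomposition.posPart,
    (ComplexMeasure.im μ).toJordanDecomposition.negPart]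

/-- The coefficients with which the Jordan pieces enter a complex measure. -/
def jordanCoeff : Fin 4 → ℂ := ![1, -1, Complex.I, -Complex.I]

instance (μ : ComplexMeasure X) (i : Fin 4) : IsFiniteMeasure (jordanPart μ i) := by
  match i with
  | 0 | 2 => exact JordanDecomposition.posPart_finite _
  | 1 | 3 => exact JordanDecomposition.negPart_finite _

lemma sum_jordanPart (μ : ComplexMeasure X) :
    ∑ i, jordanCoeff i • ofMeasure (jordanPart μ i) = μ := by
  ext s hs
  have h1 : ((ComplexMeasure.re μ) s) =
      (jordanPart μ 0).real s - (jordanPart μ 1).real s :=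
    (ComplexMeasure.re μ).apply_eq_posPart_real_sub_negPart_real hs
  have h2 : ((ComplexMeasure.im μ) s) =
      (jordanPart μ 2).real s - (jordanPart μ 3).real s :=
    (ComplexMeasure.im μ).apply_eq_posPart_real_sub_negPart_real hs
  have h1' : (μ s).re = (jordanPart μ 0).real s - (jordanPart μ 1).real s := h1
  have h2' : (μ s).im = (jordanPart μ 2).real s - (jordanPart μ 3).real s := h2
  rw [Fin.sum_univ_four]
  simp only [FunLike.coe_add, FunLike.coe_smul, Pi.add_apply, Pi.smul_apply, ofMeasure_apply _ hs]
  apply Complex.ext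
  · rw [h1']; simp [jordanCoeff]; ring
  · rw [h2']; simp [jordanCoeff]; ring

/-- Since |Re z| and |Im z| are at most |z|, the variations of the real and imaginary parts are
dominated by that of μ. Regularity and norm bounds pass to the four positive pieces through this. -/
lemma jordanPart_le_variation (μ : ComplexMeasure X) (i : Fin 4) :
    jordanPart μ i ≤ μ.variation := by
  have hre : (ComplexMeasure.re μ).totalVariation ≤ μ.variation := by
    rw [SignedMeasure.totalVariation_eq_variation]
    refine VectorMeasure.variation_le_of_forall_enorm_le fun s hs ↦ ?_
    refine le_trans ?_ (VectorMeasure.enorm_measure_le_variation μ s)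
    exact enorm_le_iff_norm_le.2 (Complex.abs_re_le_norm (μ s))
  have him : (ComplexMeasure.im μ).totalVariation ≤ μ.variation := by
    rw [SignedMeasure.totalVariation_eq_variation]
    refine VectorMeasure.variation_le_of_forall_enorm_le fun s hs ↦ ?_
    refine le_trans ?_ (VectorMeasure.enorm_measure_le_variation μ s)
    exact enorm_le_iff_norm_le.2 (Complex.abs_im_le_norm (μ s))
  fin_cases i
  · exact (Measure.le_add_right le_rfl).trans hre
  · exact (Measure.le_add_left le_rfl).trans hre
  · exact (Measure.le_add_right le_rfl).trans him
  · exact (Measure.le_add_left le_rfl).trans him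

lemma variation_smul_complex (c : ℂ) (μ : ComplexMeasure X) :
    (c • μ).variation = ‖c‖ₑ • μ.variation := by
  rw [VectorMeasure.variation_smul]
  rfl

lemma variation_sum_ofMeasure_le (c : Fin 4 → ℂ) (p : Fin 4 → Measure X)
    [∀ i, IsFiniteMeasure (p i)] :
    (∑ i, c i • ofMeasure (p i)).variation ≤ ∑ i, ‖c i‖₊ • p i := by
  refine (VectorMeasure.variation_finsetSum_le _ _).trans ?_
  refine Finset.sum_le_sum fun i _ ↦ ?_
  rw [variation_smul_complex]
  intro s
  simp only [Measure.smul_apply, Measure.nnreal_smul_coe_apply, smul_eq_mul]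
  exact mul_le_mul_right (variation_ofMeasure_le (p i) s) _

instance isFiniteMeasure_variation (μ : ComplexMeasure X) : IsFiniteMeasure μ.variation := by
  rw [← sum_jordanPart μ]
  exact isFiniteMeasure_of_le _ (variation_sum_ofMeasure_le _ _)

lemma integrable_variation_smul {c : ℂ} {μ : ComplexMeasure X} {E : Type*} [NormedAddCommGroup E]
    {f : X → E}
    (hf : Integrable f μ.variation) : Integrable f (c • μ).variation := by
  rw [variation_smul_complex]
  exact hf.smul_measure enorm_ne_top

lemma integrable_variation_add {μ ν : ComplexMeasure X} {E : Type*} [NormedAddCommGroup E]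
    {f : X → E}
    (hμ : Integrable f μ.variation) (hν : Integrable f ν.variation) :
    Integrable f (μ + ν).variation :=
  VectorMeasure.Integrable.add_vectorMeasure hμ hν

end Variation

/-! ### Integration of vector-valued functions against complex measures -/

section Integral

variable {X E F : Type*} [MeasurableSpace X]
  [NormedAddCommGroup E] [NormedSpace ℝ E] [NormedSpace ℂ E] [IsScalarTower ℝ ℂ E]
  [NormedAddCommGroup F] [NormedSpace ℝ F] [NormedSpace ℂ F] [IsScalarTower ℝ ℂ F]

lemma norm_lsmul_flip_le : ‖(ContinuousLinearMap.lsmul ℝ ℂ : ℂ →L[ℝ] E →L[ℝ] E).flip‖ ≤ 1 := by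
  refine ContinuousLinearMap.opNorm_le_bound _ zero_le_one fun v ↦ ?_
  refine ContinuousLinearMap.opNorm_le_bound _ (by positivity) fun c ↦ ?_
  simp [norm_smul, mul_comm]

lemma norm_cintegral_le_integral (μ : ComplexMeasure X) (f : X → E) :
    ‖cintegral μ f‖ ≤ ∫ x, ‖f x‖ ∂μ.variation := by
  refine VectorMeasure.norm_integral_le_integral_norm.trans ?_
  exact mul_le_of_le_one_left (integral_nonneg fun _ ↦ norm_nonneg _) norm_lsmul_flip_le

lemma norm_cintegral_le (μ : ComplexMeasure X) {f : X → E} {C : ℝ}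
    (hf : ∀ x, ‖f x‖ ≤ C) : ‖cintegral μ f‖ ≤ C * μ.variation.real Set.univ := by
  refine (norm_cintegral_le_integral μ f).trans ?_
  have h := norm_integral_le_of_norm_le_const (μ := μ.variation) (f := fun x ↦ ‖f x‖) (C := C)
    (Eventually.of_forall fun x ↦ by simpa using hf x)
  exact (Real.le_norm_self _).trans h

lemma cintegral_add {μ : ComplexMeasure X} {f g : X → E} (hf : Integrable f μ.variation)
    (hg : Integrable g μ.variation) :
    cintegral μ (fun x ↦ f x + g x) = cintegral μ f + cintegral μ g :=
  VectorMeasure.integral_fun_add hf hg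

lemma clm_cintegral [CompleteSpace E] [CompleteSpace F] (φ : E →L[ℂ] F) {μ : ComplexMeasure X}
    {f : X → E} (hf : Integrable f μ.variation) :
    φ (cintegral μ f) = cintegral μ (fun x ↦ φ (f x)) := by
  have h1 := VectorMeasure.continuousLinearMap_apply_integral (μ := μ) (f := f)
    (B := (ContinuousLinearMap.lsmul ℝ ℂ).flip) (C := φ.restrictScalars ℝ) hf
  have h2 := VectorMeasure.integral_continuousLinearMap_comp (μ := μ) (f := f)
    (B := (ContinuousLinearMap.lsmul ℝ ℂ).flip) (C := φ.restrictScalars ℝ) hf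
  refine h1.trans (Eq.trans ?_ h2.symm)
  congr 1
  ext v c
  simp

lemma cintegral_smul [CompleteSpace E] (c : ℂ) {μ : ComplexMeasure X}
    {f : X → E} (hf : Integrable f μ.variation) :
    cintegral μ (fun x ↦ c • f x) = c • cintegral μ f :=
  (clm_cintegral (c • ContinuousLinearMap.id ℂ E) hf).symm

lemma cintegral_add_measure {μ ν : ComplexMeasure X} {f : X → E}
    (hμ : Integrable f μ.variation) (hν : Integrable f ν.variation) :
    cintegral (μ + ν) f = cintegral μ f + cintegral ν f :=
  VectorMeasure.integral_add_vectorMeasure hμ hν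

lemma cintegral_smul_measure [CompleteSpace E] (c : ℂ) {μ : ComplexMeasure X} {f : X → E}
    (hf : Integrable f μ.variation) :
    cintegral (c • μ) f = c • cintegral μ f := by
  rw [← cintegral_smul c hf]
  have h2 := VectorMeasure.integral_continuousLinearMap_comp (μ := μ) (f := f)
    (B := (ContinuousLinearMap.lsmul ℝ ℂ).flip)
    (C := (c • ContinuousLinearMap.id ℂ E).restrictScalars ℝ) hf
  refine Eq.trans ?_ h2.symm
  -- Scaling the measure or scaling the vector gives the same operator-valued measure. The two
  -- integrals then differ only in the dominating measure, and these are comparable up to the factor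
  -- ‖c‖.
  have hT : (c • μ).transpose (ContinuousLinearMap.lsmul ℝ ℂ : ℂ →L[ℝ] E →L[ℝ] E).flip =
      μ.transpose ((ContinuousLinearMap.lsmul ℝ ℂ : ℂ →L[ℝ] E →L[ℝ] E).flip ∘L
        (c • ContinuousLinearMap.id ℂ E).restrictScalars ℝ) := by
    ext s hs v
    simp [VectorMeasure.transpose, smul_smul, mul_comm]
  simp only [cintegral, VectorMeasure.integral]
  rw! [hT]
  refine (setToFun_congr_measure_of_integrable ‖c‖ₑ enorm_ne_top
    (variation_smul_complex c μ).le _ _ f hf).symm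

lemma cintegral_ofMeasure (p : Measure X) [IsFiniteMeasure p] {f : X → E}
    (hf : Integrable f p) : cintegral (ofMeasure p) f = ∫ x, f x ∂p := by
  rw [← VectorMeasure.integral_toSignedMeasure]
  have hT : (ofMeasure p).transpose (ContinuousLinearMap.lsmul ℝ ℂ : ℂ →L[ℝ] E →L[ℝ] E).flip =
      p.toSignedMeasure.transpose (ContinuousLinearMap.lsmul ℝ ℝ : ℝ →L[ℝ] E →L[ℝ] E).flip := by
    ext s hs v
    change (ofMeasure p s) • v = (p.toSignedMeasure s) • v
    rw [ofMeasure_apply p hs, Measure.toSignedMeasure_apply_measurable hs]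
    exact algebraMap_smul ℂ (p.real s) v
  simp only [cintegral, VectorMeasure.integral]
  rw! [hT]
  refine (setToFun_congr_measure_of_integrable 1 ENNReal.one_ne_top ?_ _ _ f ?_).symm
  · simpa using variation_ofMeasure_le p
  · simpa using hf

lemma cintegral_sum_ofMeasure [CompleteSpace E] {ι : Type*} (s : Finset ι) (c : ι → ℂ)
    (p : ι → Measure X) [∀ i, IsFiniteMeasure (p i)] {f : X → E}
    (hf : ∀ i, Integrable f (p i)) :
    cintegral (∑ i ∈ s, c i • ofMeasure (p i)) f = ∑ i ∈ s, c i • ∫ x, f x ∂(p i) := by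
  have h0 : ∀ i, Integrable f (ofMeasure (p i)).variation := fun i ↦
    (hf i).mono_measure (variation_ofMeasure_le (p i))
  refine (VectorMeasure.integral_finsetSum_vectorMeasure fun i _ ↦
    integrable_variation_smul (h0 i)).trans ?_
  refine Finset.sum_congr rfl fun i _ ↦ ?_
  rw [← cintegral_ofMeasure (p i) (hf i)]
  exact cintegral_smul_measure (c i) (h0 i)

lemma cintegral_eq_sum [CompleteSpace E] (μ : ComplexMeasure X) {f : X → E}
    (hf : ∀ i, Integrable f (jordanPart μ i)) :
    cintegral μ f = ∑ i, jordanCoeff i • ∫ x, f x ∂(jordanPart μ i) := by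
  conv_lhs => rw [← sum_jordanPart μ]
  exact cintegral_sum_ofMeasure _ _ _ hf

lemma cintegral_dirac [MeasurableSingletonClass X] [CompleteSpace E] (a : X) (f : X → E) :
    cintegral (VectorMeasure.dirac a (1 : ℂ)) f = f a := by
  refine VectorMeasure.integral_dirac.trans ?_
  simp

end Integral

/-! ### Stability of regularity -/

section Regular

variable {X : Type*} [TopologicalSpace X] [T2Space X] [MeasurableSpace X] [BorelSpace X]

/-- A compact K ⊆ s with q(s \ K) small also has p(s \ K) small. Every regularity claim about
combinations of measures reduces to this domination. -/
lemma regular_of_le {p q : Measure X} [IsFiniteMeasure q] [q.Regular] (h : p ≤ q) :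
    p.Regular := by
  have : IsFiniteMeasure p := isFiniteMeasure_of_le q h
  have : p.InnerRegularCompactLTTop := by
    refine ⟨fun s hs r hr ↦ ?_⟩
    by_cases h0 : p s = 0
    · exact absurd (h0 ▸ hr) (by simp)
    have hε : p s - r ≠ 0 := (tsub_pos_of_lt hr).ne'
    obtain ⟨K, hKs, hK, hlt⟩ :=
      hs.1.exists_isCompact_sdiff_lt (measure_ne_top q s) (ε := p s - r) hε
    refine ⟨K, hKs, hK, ?_⟩
    by_contra! hle
    have h1 : p s - r ≤ p (s \ K) := (tsub_le_tsub_left hle _).trans le_measure_sdiff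
    exact absurd ((h1.trans (h _)).trans_lt hlt) (lt_irrefl _)
  infer_instance

lemma jordanPart_regular {μ : ComplexMeasure X} (h : IsRegular μ) (i : Fin 4) :
    (jordanPart μ i).Regular :=
  have : μ.variation.Regular := h
  regular_of_le (jordanPart_le_variation μ i)

lemma isRegular_of_le {μ : ComplexMeasure X} {q : Measure X} [IsFiniteMeasure q] [q.Regular]
    (h : μ.variation ≤ q) : IsRegular μ :=
  regular_of_le h

lemma regular_add {p q : Measure X} [IsFiniteMeasure p] [IsFiniteMeasure q] [p.Regular]
    [q.Regular] : (p + q).Regular :=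
  inferInstance

lemma isRegular_ofMeasure (p : Measure X) [IsFiniteMeasure p] [p.Regular] :
    IsRegular (ofMeasure p) :=
  isRegular_of_le (variation_ofMeasure_le p)

lemma IsRegular.add {μ ν : ComplexMeasure X} (hμ : IsRegular μ) (hν : IsRegular ν) :
    IsRegular (μ + ν) := by
  have : μ.variation.Regular := hμ
  have : ν.variation.Regular := hν
  have := regular_add (p := μ.variation) (q := ν.variation)
  exact isRegular_of_le VectorMeasure.variation_add_le

lemma IsRegular.smul {μ : ComplexMeasure X} (hμ : IsRegular μ) (c : ℂ) :
    IsRegular (c • μ) := by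
  have : μ.variation.Regular := hμ
  have h : (c • μ).variation = ‖c‖₊ • μ.variation := variation_smul_complex c μ
  exact isRegular_of_le h.le

lemma isRegular_zero : IsRegular (0 : ComplexMeasure X) :=
  isRegular_of_le (q := 0) (by simp)

lemma isRegular_sum {ι : Type*} (s : Finset ι) {μ : ι → ComplexMeasure X}
    (h : ∀ i, IsRegular (μ i)) : IsRegular (∑ i ∈ s, μ i) := by
  classical
  induction s using Finset.induction_on with
  | empty => simpa using isRegular_zero
  | insert a s ha ih => rw [Finset.sum_insert ha]; exact (h a).add ih

lemma isRegular_dirac (a : X) : IsRegular (VectorMeasure.dirac a (1 : ℂ)) := by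
  have : (Measure.dirac a).InnerRegularCompactLTTop := by
    refine ⟨fun s hs r hr ↦ ?_⟩
    rw [Measure.dirac_apply' a hs.1] at hr
    have ha : a ∈ s := by
      by_contra ha
      simp [ha] at hr
    refine ⟨{a}, by simpa using ha, isCompact_singleton, ?_⟩
    simpa [ha] using hr
  exact isRegular_of_le (q := Measure.dirac a) (by simp)

end Regular

end MeasAlg

end

noncomputable section

namespace MeasAlg

/-! ### Tightness of finite regular measures -/

section Tight

variable {X E : Type*} [TopologicalSpace X] [T2Space X] [MeasurableSpace X] [BorelSpace X]
  [NormedAddCommGroup E] [NormedSpace ℝ E]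

lemma exists_isCompact_measureReal_compl_lt (p : Measure X) [IsFiniteMeasure p] [p.Regular]
    {ε : ℝ} (hε : 0 < ε) : ∃ K, IsCompact K ∧ p.real Kᶜ < ε := by
  obtain ⟨K, -, hK, hlt⟩ := MeasurableSet.univ.exists_isCompact_sdiff_lt
    (measure_ne_top p Set.univ) (ε := ENNReal.ofReal ε) (by simpa using hε)
  refine ⟨K, hK, ?_⟩
  rw [← Set.compl_eq_univ_sdiff] at hlt
  exact (ENNReal.lt_ofReal_iff_toReal_lt (measure_ne_top _ _)).1 hlt

omit [T2Space X] [TopologicalSpace X] [BorelSpace X] in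
lemma norm_integral_le_of_norm_le_on (p : Measure X) [IsFiniteMeasure p] {f : X → E} {K : Set X}
    (hK : MeasurableSet K) {ε C : ℝ} (hε : 0 ≤ ε)
    (hfK : ∀ x ∈ K, ‖f x‖ ≤ ε) (hf : ∀ x, ‖f x‖ ≤ C) :
    ‖∫ x, f x ∂p‖ ≤ ε * p.real Set.univ + C * p.real Kᶜ := by
  have hi : Integrable (Kᶜ.indicator fun _ ↦ C) p :=
    (integrable_const C).indicator hK.compl
  have h : ‖∫ x, f x ∂p‖ ≤ ∫ x, (ε + Kᶜ.indicator (fun _ ↦ C) x) ∂p := by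
    refine norm_integral_le_of_norm_le ((integrable_const ε).add hi)
      (Eventually.of_forall fun x ↦ ?_)
    by_cases hx : x ∈ K
    · simpa [hx] using hfK x hx
    · simpa [hx] using (hf x).trans (by linarith)
  refine h.trans (le_of_eq ?_)
  rw [integral_add (integrable_const ε) hi, integral_indicator_const _ hK.compl]
  simp [mul_comm]

omit [T2Space X] [NormedSpace ℝ E] in
lemma integrable_of_continuous_of_bound (p : Measure X) [IsFiniteMeasure p]
    [SecondCountableTopology E] {f : X → E} (hf : Continuous f) {C : ℝ} (hC : ∀ x, ‖f x‖ ≤ C) :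
    Integrable f p :=
  Integrable.of_bound hf.aestronglyMeasurable C (Eventually.of_forall hC)

end Tight

/-! ### Integrals depending on a parameter -/

section Parametric

variable {X Y : Type*} [TopologicalSpace X] [TopologicalSpace Y] [T2Space Y] [MeasurableSpace Y]
  [BorelSpace Y] (q : Measure Y) [IsFiniteMeasure q] [q.Regular]

/-- The neighbourhood filter of x₀ need not be countably generated, so dominated convergence is
replaced by tightness: F x is uniformly close to F x₀ on a large compact set, and the rest of the
space has small mass. -/
lemma continuous_integral_of_bound {F : X → Y → ℂ} (hF : Continuous F.uncurry)
    {C : ℝ} (hC : ∀ x y, ‖F x y‖ ≤ C) : Continuous fun x ↦ ∫ y, F x y ∂q := by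
  rw [continuous_iff_continuousAt]
  intro x₀
  rw [ContinuousAt, Metric.tendsto_nhds]
  intro ε hε
  -- C can be negative when Y is empty.
  set C' := max C 0 with hC'
  have hC'0 : 0 ≤ C' := le_max_right _ _
  have hCC' : ∀ x y, ‖F x y‖ ≤ C' := fun x y ↦ (hC x y).trans (le_max_left _ _)
  obtain ⟨K, hK, hqK⟩ := exists_isCompact_measureReal_compl_lt q
    (ε := ε / (4 * (C' + 1))) (by positivity)
  set M := q.real Set.univ with hM
  have hM0 : 0 ≤ M := measureReal_nonneg
  set η := ε / (4 * (M + 1)) with hη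
  have hη0 : 0 < η := by positivity
  have hcont : ∀ x, Continuous (F x) := fun x ↦ hF.comp (by fun_prop : Continuous fun y ↦ (x, y))
  have hev : ∀ᶠ x in 𝓝 x₀, ∀ y ∈ K, ‖F x y - F x₀ y‖ ≤ η := by
    refine hK.eventually_forall_of_forall_eventually fun y _ ↦ ?_
    have h1 : Continuous fun z : X × Y ↦ ‖F z.1 z.2 - F x₀ z.2‖ :=
      (hF.sub ((hcont x₀).comp continuous_snd)).norm
    have h2 := h1.tendsto (x₀, y)
    simp only [sub_self, norm_zero] at h2
    exact (h2.eventually (gt_mem_nhds hη0)).mono fun _ h ↦ h.le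
  filter_upwards [hev] with x hx
  rw [dist_eq_norm, ← integral_sub (integrable_of_continuous_of_bound q (hcont x) (hC x))
    (integrable_of_continuous_of_bound q (hcont x₀) (hC x₀))]
  refine (norm_integral_le_of_norm_le_on q hK.measurableSet hη0.le
    (C := 2 * C') hx fun y ↦ ?_).trans_lt ?_
  · exact (norm_sub_le _ _).trans (by linarith [hCC' x y, hCC' x₀ y])
  · have h1 : η * M ≤ ε / 4 := by
      rw [hη, div_mul_eq_mul_div, div_le_div_iff₀ (by positivity) (by norm_num)]
      nlinarith
    have h2 : 2 * C' * q.real Kᶜ ≤ 2 * (C' * (ε / (4 * (C' + 1)))) := by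
      rw [mul_assoc]; gcongr
    have h3 : C' * (ε / (4 * (C' + 1))) ≤ ε / 4 := by
      rw [mul_div_assoc', div_le_div_iff₀ (by positivity) (by norm_num)]
      nlinarith
    linarith

lemma tendsto_integral_cocompact_of_bound {F : X → Y → ℂ}
    {C : ℝ} (hC : ∀ x y, ‖F x y‖ ≤ C)
    (h0 : ∀ K : Set Y, IsCompact K → ∀ ε > 0, ∀ᶠ x in cocompact X, ∀ y ∈ K, ‖F x y‖ ≤ ε) :
    Tendsto (fun x ↦ ∫ y, F x y ∂q) (cocompact X) (𝓝 0) := by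
  rw [Metric.tendsto_nhds]
  intro ε hε
  set C' := max C 0 with hC'
  have hC'0 : 0 ≤ C' := le_max_right _ _
  have hCC' : ∀ x y, ‖F x y‖ ≤ C' := fun x y ↦ (hC x y).trans (le_max_left _ _)
  obtain ⟨K, hK, hqK⟩ := exists_isCompact_measureReal_compl_lt q
    (ε := ε / (4 * (C' + 1))) (by positivity)
  set M := q.real Set.univ with hM
  have hM0 : 0 ≤ M := measureReal_nonneg
  have hη0 : 0 < ε / (4 * (M + 1)) := by positivity
  filter_upwards [h0 K hK _ hη0] with x hx
  rw [dist_zero_right]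
  refine (norm_integral_le_of_norm_le_on q hK.measurableSet hη0.le hx (hCC' x)).trans_lt ?_
  have h1 : ε / (4 * (M + 1)) * M ≤ ε / 4 := by
    rw [div_mul_eq_mul_div, div_le_div_iff₀ (by positivity) (by norm_num)]
    nlinarith
  have h2 : C' * q.real Kᶜ ≤ C' * (ε / (4 * (C' + 1))) := by gcongr
  have h3 : C' * (ε / (4 * (C' + 1))) ≤ ε / 4 := by
    rw [mul_div_assoc', div_le_div_iff₀ (by positivity) (by norm_num)]
    nlinarith
  linarith

end Parametric

/-! ### Interchange of integrals for finite regular measures -/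

section Fubini

variable {X Y : Type*} [TopologicalSpace X] [T2Space X] [LocallyCompactSpace X]
  [MeasurableSpace X] [BorelSpace X]
  [TopologicalSpace Y] [T2Space Y] [LocallyCompactSpace Y] [MeasurableSpace Y] [BorelSpace Y]
  (p : Measure X) [IsFiniteMeasure p] [p.Regular] (q : Measure Y) [IsFiniteMeasure q] [q.Regular]

omit [LocallyCompactSpace X] [LocallyCompactSpace Y] [p.Regular] in
lemma norm_integral_integral_sub_cutoff_le {F : X → Y → ℂ} (hF : Continuous F.uncurry)
    {C : ℝ} (hC0 : 0 ≤ C) (hC : ∀ x y, ‖F x y‖ ≤ C) {K : Set X} {L : Set Y} (hK : IsCompact K)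
    (hL : IsCompact L) {χ : C(X, ℝ)} {ψ : C(Y, ℝ)} (hχK : Set.EqOn χ 1 K) (hψL : Set.EqOn ψ 1 L)
    (hχ : ∀ x, χ x ∈ Set.Icc (0 : ℝ) 1) (hψ : ∀ y, ψ y ∈ Set.Icc (0 : ℝ) 1) :
    ‖∫ x, ∫ y, F x y ∂q ∂p - ∫ x, ∫ y, ((χ x * ψ y : ℝ) : ℂ) * F x y ∂q ∂p‖ ≤
      C * q.real Lᶜ * p.real Set.univ + C * q.real Set.univ * p.real Kᶜ := by
  have hcont : ∀ x, Continuous (F x) := fun x ↦ hF.comp (by fun_prop : Continuous fun y ↦ (x, y))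
  have hm : ∀ x y, ‖((χ x * ψ y : ℝ) : ℂ)‖ ≤ 1 := fun x y ↦ by
    rw [Complex.norm_real, Real.norm_of_nonneg (mul_nonneg (hχ x).1 (hψ y).1)]
    exact mul_le_one₀ (hχ x).2 (hψ y).1 (hψ y).2
  have hm' : ∀ x y, ‖(1 : ℂ) - ((χ x * ψ y : ℝ) : ℂ)‖ ≤ 1 := fun x y ↦ by
    have h0 := mul_nonneg (hχ x).1 (hψ y).1
    have h1 := mul_le_one₀ (hχ x).2 (hψ y).1 (hψ y).2
    rw [← Complex.ofReal_one, ← Complex.ofReal_sub, Complex.norm_real, Real.norm_of_nonneg] <;>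
      linarith
  have hF2 : Continuous (fun x y ↦ ((χ x * ψ y : ℝ) : ℂ) * F x y).uncurry := by
    have : Continuous fun z : X × Y ↦ ((χ z.1 * ψ z.2 : ℝ) : ℂ) := by fun_prop
    exact this.mul hF
  have hC2 : ∀ x y, ‖((χ x * ψ y : ℝ) : ℂ) * F x y‖ ≤ C := fun x y ↦ by
    rw [norm_mul]
    exact (mul_le_of_le_one_left (norm_nonneg _) (hm x y)).trans (hC x y)
  have hcont2 : ∀ x, Continuous fun y ↦ ((χ x * ψ y : ℝ) : ℂ) * F x y := fun x ↦
    hF2.comp (by fun_prop : Continuous fun y ↦ (x, y))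
  have hb : ∀ {H : X → Y → ℂ} (_ : ∀ x y, ‖H x y‖ ≤ C) (x : X), ‖∫ y, H x y ∂q‖ ≤
      C * q.real Set.univ := fun hH x ↦
    norm_integral_le_of_norm_le_const (Eventually.of_forall (hH x))
  have hdiff : ∀ x, ∫ y, F x y ∂q - ∫ y, ((χ x * ψ y : ℝ) : ℂ) * F x y ∂q =
      ∫ y, (1 - ((χ x * ψ y : ℝ) : ℂ)) * F x y ∂q := fun x ↦ by
    rw [← integral_sub (integrable_of_continuous_of_bound q (hcont x) (hC x))
      (integrable_of_continuous_of_bound q (hcont2 x) (hC2 x))]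
    simp only [sub_mul, one_mul]
  rw [← integral_sub
    (integrable_of_continuous_of_bound p (continuous_integral_of_bound q hF hC) (hb hC))
    (integrable_of_continuous_of_bound p (continuous_integral_of_bound q hF2 hC2) (hb hC2))]
  have hC3 : ∀ x y, ‖(1 - ((χ x * ψ y : ℝ) : ℂ)) * F x y‖ ≤ C := fun x y ↦ by
    rw [norm_mul]
    exact (mul_le_of_le_one_left (norm_nonneg _) (hm' x y)).trans (hC x y)
  refine norm_integral_le_of_norm_le_on p hK.measurableSet (by positivity) ?_ ?_
  · intro x hx
    rw [hdiff]
    refine (norm_integral_le_of_norm_le_on q hL.measurableSet le_rfl ?_ (hC3 x)).trans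
      (by simp)
    intro y hy
    simp [hχK hx, hψL hy]
  · intro x
    rw [hdiff]
    exact hb hC3 x

/-- A continuous F need not be measurable for the product σ-algebra. For compact support the
interchange still holds; by tightness, multiplying F by cutoffs χ(x)ψ(y) changes both iterated
integrals by as little as desired. -/
lemma integral_integral_swap_of_bound {F : X → Y → ℂ} (hF : Continuous F.uncurry)
    {C : ℝ} (hC : ∀ x y, ‖F x y‖ ≤ C) :
    ∫ x, ∫ y, F x y ∂q ∂p = ∫ y, ∫ x, F x y ∂p ∂q := by
  set C' := max C 0 with hC'
  have hC'0 : 0 ≤ C' := le_max_right _ _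
  have hCC' : ∀ x y, ‖F x y‖ ≤ C' := fun x y ↦ (hC x y).trans (le_max_left _ _)
  rw [← sub_eq_zero, ← norm_eq_zero]
  refine le_antisymm (le_of_forall_pos_le_add fun ε hε ↦ ?_) (norm_nonneg _)
  set A := p.real Set.univ with hA
  set B := q.real Set.univ with hB
  have hA0 : 0 ≤ A := measureReal_nonneg
  have hB0 : 0 ≤ B := measureReal_nonneg
  set η := ε / (2 * (C' * (A + B) + 1)) with hη
  have hη0 : 0 < η := by positivity
  obtain ⟨K, hK, hpK⟩ := exists_isCompact_measureReal_compl_lt p hη0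
  obtain ⟨L, hL, hqL⟩ := exists_isCompact_measureReal_compl_lt q hη0
  obtain ⟨χ, hχK, -, hχc, hχ⟩ := exists_continuous_one_zero_of_isCompact hK isClosed_empty
    (Set.disjoint_empty K)
  obtain ⟨ψ, hψL, -, hψc, hψ⟩ := exists_continuous_one_zero_of_isCompact hL isClosed_empty
    (Set.disjoint_empty L)
  have h1 := norm_integral_integral_sub_cutoff_le p q hF hC'0 hCC' hK hL hχK hψL hχ hψ
  have hFs : Continuous (fun y x ↦ F x y).uncurry := hF.comp continuous_swap
  have h2 := norm_integral_integral_sub_cutoff_le q p hFs hC'0 (fun y x ↦ hCC' x y) hL hK hψL hχK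
    hψ hχ
  have hswap : ∫ x, ∫ y, ((χ x * ψ y : ℝ) : ℂ) * F x y ∂q ∂p =
      ∫ y, ∫ x, ((ψ y * χ x : ℝ) : ℂ) * F x y ∂p ∂q := by
    simp_rw [mul_comm (ψ _) (χ _)]
    refine integral_integral_swap_of_hasCompactSupport ?_ ?_
    · have : Continuous fun z : X × Y ↦ ((χ z.1 * ψ z.2 : ℝ) : ℂ) := by fun_prop
      exact this.mul hF
    · refine HasCompactSupport.intro (hχc.isCompact.prod hψc.isCompact) fun z hz ↦ ?_
      rw [Set.mem_prod, not_and_or] at hz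
      rcases hz with hz | hz
      · simp [Function.uncurry, image_eq_zero_of_notMem_tsupport hz]
      · simp [Function.uncurry, image_eq_zero_of_notMem_tsupport hz]
  rw [hswap] at h1
  rw [norm_sub_rev] at h2
  have h3 := norm_sub_le_norm_sub_add_norm_sub (∫ x, ∫ y, F x y ∂q ∂p)
    (∫ y, ∫ x, ((ψ y * χ x : ℝ) : ℂ) * F x y ∂p ∂q) (∫ y, ∫ x, F x y ∂p ∂q)
  have h4 : C' * q.real Lᶜ * A + C' * B * p.real Kᶜ ≤ C' * (A + B) * η := by
    have e1 : C' * q.real Lᶜ * A ≤ C' * η * A := by gcongr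
    have e2 : C' * B * p.real Kᶜ ≤ C' * B * η := by gcongr
    nlinarith
  have h5 : C' * p.real Kᶜ * B + C' * A * q.real Lᶜ ≤ C' * (A + B) * η := by
    have e1 : C' * p.real Kᶜ * B ≤ C' * η * B := by gcongr
    have e2 : C' * A * q.real Lᶜ ≤ C' * A * η := by gcongr
    nlinarith
  have h6 : C' * (A + B) * η ≤ ε / 2 := by
    have : 0 ≤ C' * (A + B) := by positivity
    rw [hη, mul_div_assoc', div_le_div_iff₀ (by positivity) (by norm_num)]
    nlinarith
  linarith

end Fubini

/-! ### Riesz representation of positive functionals on C₀ -/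

section Riesz

variable {X : Type*} [TopologicalSpace X] [T2Space X] [LocallyCompactSpace X]

/-- A continuous compactly supported function, as a function vanishing at infinity. -/
def ofCompactSupport (f : X → ℂ) (hf : Continuous f) (hc : HasCompactSupport f) : C₀(X, ℂ) :=
  ⟨⟨f, hf⟩, hc.is_zero_at_infty⟩

omit [T2Space X] [LocallyCompactSpace X] in
lemma norm_apply_le_norm (f : C₀(X, ℂ)) (x : X) : ‖f x‖ ≤ ‖f‖ :=
  f.toBCF.norm_coe_le_norm x

omit [T2Space X] [LocallyCompactSpace X] in
lemma norm_le_of_forall {f : C₀(X, ℂ)} {C : ℝ} (hC : 0 ≤ C) (h : ∀ x, ‖f x‖ ≤ C) : ‖f‖ ≤ C :=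
  (BoundedContinuousFunction.norm_le (f := f.toBCF) hC).2 h

lemma exists_hasCompactSupport_norm_sub_le (f : C₀(X, ℂ)) {ε : ℝ} (hε : 0 < ε) :
    ∃ g : C₀(X, ℂ), HasCompactSupport g ∧ ‖f - g‖ ≤ ε := by
  have h := (f.zero_at_infty').eventually (Metric.closedBall_mem_nhds 0 hε)
  obtain ⟨K, hK, hKf⟩ := mem_cocompact.1 h
  obtain ⟨χ, hχK, -, hχc, hχ⟩ := exists_continuous_one_zero_of_isCompact hK isClosed_empty
    (Set.disjoint_empty K)
  have hgc : HasCompactSupport fun x ↦ (χ x : ℂ) * f x :=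
    (hχc.comp_left (g := fun r : ℝ ↦ (r : ℂ)) Complex.ofReal_zero).mul_right
  refine ⟨ofCompactSupport (fun x ↦ (χ x : ℂ) * f x) (by fun_prop) hgc, hgc,
    norm_le_of_forall hε.le fun x ↦ ?_⟩
  change ‖f x - (χ x : ℂ) * f x‖ ≤ ε
  by_cases hx : x ∈ K
  · simp [hχK hx, hε.le]
  · have hfx : ‖f x‖ ≤ ε := by simpa using hKf hx
    have : f x - (χ x : ℂ) * f x = ((1 - χ x : ℝ) : ℂ) * f x := by push_cast; ring
    rw [this, norm_mul, Complex.norm_real, Real.norm_of_nonneg (by linarith [(hχ x).2])]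
    exact (mul_le_of_le_one_left (norm_nonneg _) (by linarith [(hχ x).1])).trans hfx

variable [MeasurableSpace X] [BorelSpace X]

omit [T2Space X] [LocallyCompactSpace X] in
lemma integrable_zeroAtInfty (p : Measure X) [IsFiniteMeasure p] (f : C₀(X, ℂ)) :
    Integrable f p :=
  integrable_of_continuous_of_bound p (map_continuous f) (norm_apply_le_norm f)

/-- Integration against a finite measure as a functional on `C₀`. -/
def integralCLM (p : Measure X) [IsFiniteMeasure p] : C₀(X, ℂ) →L[ℂ] ℂ :=
  LinearMap.mkContinuous
    { toFun := fun f ↦ ∫ x, f x ∂p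
      map_add' := fun f g ↦ integral_add (integrable_zeroAtInfty p f) (integrable_zeroAtInfty p g)
      map_smul' := fun c f ↦ integral_const_mul c f }
    (p.real Set.univ) fun f ↦ by
      rw [mul_comm]
      exact norm_integral_le_of_norm_le_const (Eventually.of_forall (norm_apply_le_norm f))

open scoped CompactlySupported

/-- The real Riesz theorem on compactly supported functions supplies the measure; boundedness of Λ
makes it finite, and density of compactly supported functions extends the formula to C₀. -/
theorem exists_measure_of_positive (Λ : C₀(X, ℂ) →L[ℂ] ℂ)
    (hreal : ∀ f : C₀(X, ℂ), (∀ x, (f x).im = 0) → (Λ f).im = 0)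
    (hpos : ∀ f : C₀(X, ℂ), (∀ x, 0 ≤ (f x).re) → (∀ x, (f x).im = 0) → 0 ≤ (Λ f).re) :
    ∃ p : Measure X, IsFiniteMeasure p ∧ p.Regular ∧ ∀ f : C₀(X, ℂ), Λ f = ∫ x, f x ∂p := by
  have hcs : ∀ f : C_c(X, ℝ), HasCompactSupport fun x ↦ (f x : ℂ) := fun f ↦
    f.hasCompactSupport.comp_left (g := fun r : ℝ ↦ (r : ℂ)) Complex.ofReal_zero
  let J : C_c(X, ℝ) → C₀(X, ℂ) := fun f ↦
    ofCompactSupport (fun x ↦ (f x : ℂ)) (by fun_prop) (hcs f)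
  let Λ₀ : C_c(X, ℝ) →ₗ[ℝ] ℝ :=
    { toFun := fun f ↦ (Λ (J f)).re
      map_add' := fun f g ↦ by
        have : J (f + g) = J f + J g := by ext x; simp [J, ofCompactSupport]
        rw [this, map_add, Complex.add_re]
      map_smul' := fun c f ↦ by
        have : J (c • f) = (c : ℂ) • J f := by ext x; simp [J, ofCompactSupport]
        rw [this, map_smul]
        simp }
  let Λ₁ : C_c(X, ℝ) →ₚ[ℝ] ℝ := PositiveLinearMap.mk₀ Λ₀ fun f hf ↦
    hpos (J f) (fun x ↦ hf x) fun x ↦ Complex.ofReal_im _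
  have hreg : (RealRMK.rieszMeasure Λ₁).Regular := inferInstance
  set p := RealRMK.rieszMeasure Λ₁ with hp
  have hfin : IsFiniteMeasure p := by
    -- A cutoff equal to 1 on K has norm at most 1, so each compact K has mass at most ‖Λ‖; inner
    -- regularity carries the bound to the whole space.
    refine ⟨lt_of_le_of_lt ?_ (ENNReal.ofReal_lt_top (r := ‖Λ‖))⟩
    rw [isOpen_univ.measure_eq_iSup_isCompact p]
    refine iSup_le fun K ↦ iSup_le fun _ ↦ iSup_le fun hK ↦ ?_
    obtain ⟨χ, hχK, -, hχc, hχ⟩ := exists_continuous_one_zero_of_isCompact hK isClosed_empty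
      (Set.disjoint_empty K)
    have h1 := RealRMK.rieszMeasure_le_of_eq_one Λ₁ (f := ⟨χ, hχc⟩) (fun x ↦ (hχ x).1) hK
      (fun x hx ↦ hχK hx)
    refine h1.trans (ENNReal.ofReal_le_ofReal ?_)
    have h2 : ‖J ⟨χ, hχc⟩‖ ≤ 1 := norm_le_of_forall zero_le_one fun x ↦ by
      change ‖((χ x : ℝ) : ℂ)‖ ≤ 1
      rw [Complex.norm_real, Real.norm_of_nonneg (hχ x).1]
      exact (hχ x).2
    calc (Λ (J ⟨χ, hχc⟩)).re ≤ ‖Λ (J ⟨χ, hχc⟩)‖ := Complex.re_le_norm _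
      _ ≤ ‖Λ‖ * ‖J ⟨χ, hχc⟩‖ := Λ.le_opNorm _
      _ ≤ ‖Λ‖ := mul_le_of_le_one_right Λ.opNorm_nonneg h2
  refine ⟨p, hfin, hreg, ?_⟩
  have hJ : ∀ f : C_c(X, ℝ), Λ (J f) = ∫ x, J f x ∂p := fun f ↦ by
    have h1 : ∫ x, f x ∂p = (Λ (J f)).re := RealRMK.integral_rieszMeasure Λ₁ f
    have h2 : ∫ x, J f x ∂p = ((∫ x, f x ∂p : ℝ) : ℂ) := integral_ofReal
    rw [h2, h1]
    apply Complex.ext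
    · simp
    · simpa using hreal (J f) fun x ↦ Complex.ofReal_im _
  have hcompact : ∀ g : C₀(X, ℂ), HasCompactSupport g → Λ g = integralCLM p g := fun g hg ↦ by
    let gr : C_c(X, ℝ) := ⟨⟨fun x ↦ (g x).re, by fun_prop⟩,
      hg.comp_left (g := Complex.re) Complex.zero_re⟩
    let gi : C_c(X, ℝ) := ⟨⟨fun x ↦ (g x).im, by fun_prop⟩,
      hg.comp_left (g := Complex.im) Complex.zero_im⟩
    have hdec : g = J gr + Complex.I • J gi := by
      ext x
      change g x = ((g x).re : ℂ) + Complex.I * ((g x).im : ℂ)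
      rw [mul_comm, Complex.re_add_im]
    rw [hdec, map_add, map_add, map_smul, map_smul, hJ, hJ]
    rfl
  intro f
  have hcl : IsClosed {f : C₀(X, ℂ) | Λ f = integralCLM p f} :=
    isClosed_eq Λ.continuous (integralCLM p).continuous
  have hmem : f ∈ closure {f : C₀(X, ℂ) | Λ f = integralCLM p f} := by
    rw [Metric.mem_closure_iff]
    intro ε hε
    obtain ⟨g, hg, hfg⟩ := exists_hasCompactSupport_norm_sub_le f (half_pos hε)
    exact ⟨g, hcompact g hg, by rw [dist_eq_norm]; linarith⟩
  have hmem' := hcl.closure_eq.subset hmem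
  exact hmem'

end Riesz

end MeasAlg

end

noncomputable section

namespace MeasAlg

/-! ### Iterated integrals against complex measures -/

section BoundedContinuous

variable {X Y : Type*} [TopologicalSpace X] [TopologicalSpace Y] [T2Space Y] [MeasurableSpace Y]
  [BorelSpace Y]

omit [T2Space Y] in
lemma cintegral_eq_sum_of_bound (ν : ComplexMeasure Y) {f : Y → ℂ} (hf : Continuous f) {C : ℝ}
    (hC : ∀ y, ‖f y‖ ≤ C) :
    cintegral ν f = ∑ i, jordanCoeff i • ∫ y, f y ∂(jordanPart ν i) :=
  cintegral_eq_sum ν fun i ↦ integrable_of_continuous_of_bound (jordanPart ν i) hf hC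

variable {ν : ComplexMeasure Y}

lemma continuous_cintegral_of_bound (hν : IsRegular ν) {F : X → Y → ℂ}
    (hF : Continuous F.uncurry) {C : ℝ} (hC : ∀ x y, ‖F x y‖ ≤ C) :
    Continuous fun x ↦ cintegral ν (F x) := by
  have hcont : ∀ x, Continuous (F x) := fun x ↦ hF.comp (by fun_prop : Continuous fun y ↦ (x, y))
  have h : (fun x ↦ cintegral ν (F x)) =
      fun x ↦ ∑ i, jordanCoeff i • ∫ y, F x y ∂(jordanPart ν i) :=
    funext fun x ↦ cintegral_eq_sum_of_bound ν (hcont x) (hC x)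
  rw [h]
  refine continuous_finsetSum _ fun i _ ↦ ?_
  have := jordanPart_regular hν i
  exact (continuous_integral_of_bound (jordanPart ν i) hF hC).const_smul (jordanCoeff i)

lemma tendsto_cintegral_cocompact_of_bound (hν : IsRegular ν) {F : X → Y → ℂ}
    (hF : Continuous F.uncurry) {C : ℝ} (hC : ∀ x y, ‖F x y‖ ≤ C)
    (h0 : ∀ K : Set Y, IsCompact K → ∀ ε > 0, ∀ᶠ x in cocompact X, ∀ y ∈ K, ‖F x y‖ ≤ ε) :
    Tendsto (fun x ↦ cintegral ν (F x)) (cocompact X) (𝓝 0) := by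
  have hcont : ∀ x, Continuous (F x) := fun x ↦ hF.comp (by fun_prop : Continuous fun y ↦ (x, y))
  have h : (fun x ↦ cintegral ν (F x)) =
      fun x ↦ ∑ i, jordanCoeff i • ∫ y, F x y ∂(jordanPart ν i) :=
    funext fun x ↦ cintegral_eq_sum_of_bound ν (hcont x) (hC x)
  have hz : (0 : ℂ) = ∑ i : Fin 4, jordanCoeff i • (0 : ℂ) := by simp
  rw [h, hz]
  refine tendsto_finsetSum _ fun i _ ↦ ?_
  have := jordanPart_regular hν i
  exact (tendsto_integral_cocompact_of_bound (jordanPart ν i) hC h0).const_smul _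

lemma cintegral_cintegral_eq_sum [MeasurableSpace X] [BorelSpace X] (μ : ComplexMeasure X)
    (hν : IsRegular ν) {F : X → Y → ℂ}
    (hF : Continuous F.uncurry) {C : ℝ} (hC : ∀ x y, ‖F x y‖ ≤ C) :
    cintegral μ (fun x ↦ cintegral ν (F x)) = ∑ i, ∑ j, (jordanCoeff i * jordanCoeff j) •
      ∫ x, ∫ y, F x y ∂(jordanPart ν j) ∂(jordanPart μ i) := by
  have hcont : ∀ x, Continuous (F x) := fun x ↦ hF.comp (by fun_prop : Continuous fun y ↦ (x, y))
  rw [cintegral_eq_sum_of_bound μ (continuous_cintegral_of_bound hν hF hC)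
    (fun x ↦ norm_cintegral_le ν (hC x))]
  refine Finset.sum_congr rfl fun i _ ↦ ?_
  simp_rw [fun x ↦ cintegral_eq_sum_of_bound ν (hcont x) (hC x)]
  have hint : ∀ j, Integrable (fun x ↦ ∫ y, F x y ∂(jordanPart ν j)) (jordanPart μ i) := fun j ↦ by
    have := jordanPart_regular hν j
    exact integrable_of_continuous_of_bound _ (continuous_integral_of_bound _ hF hC)
      fun x ↦ norm_integral_le_of_norm_le_const (Eventually.of_forall (hC x))
  rw [integral_finsetSum _ fun j _ ↦ (hint j).fun_smul (jordanCoeff j), Finset.smul_sum]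
  refine Finset.sum_congr rfl fun j _ ↦ ?_
  rw [integral_smul, smul_smul]

lemma cintegral_cintegral_swap [T2Space X] [LocallyCompactSpace X] [LocallyCompactSpace Y]
    [MeasurableSpace X] [BorelSpace X] {μ : ComplexMeasure X} (hμ : IsRegular μ)
    (hν : IsRegular ν) {F : X → Y → ℂ}
    (hF : Continuous F.uncurry) {C : ℝ} (hC : ∀ x y, ‖F x y‖ ≤ C) :
    cintegral μ (fun x ↦ cintegral ν fun y ↦ F x y) =
      cintegral ν (fun y ↦ cintegral μ fun x ↦ F x y) := by
  have hFs : Continuous (fun y x ↦ F x y).uncurry := hF.comp continuous_swap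
  rw [cintegral_cintegral_eq_sum μ hν hF hC,
    cintegral_cintegral_eq_sum ν hμ hFs fun y x ↦ hC x y, Finset.sum_comm]
  refine Finset.sum_congr rfl fun j _ ↦ Finset.sum_congr rfl fun i _ ↦ ?_
  have := jordanPart_regular hν j
  have := jordanPart_regular hμ i
  rw [integral_integral_swap_of_bound _ _ hF hC, mul_comm]

end BoundedContinuous

/-! ### Complex measures as functionals on C₀ -/

section ZeroAtInfty

variable {X : Type*} [TopologicalSpace X] [MeasurableSpace X] [BorelSpace X]

lemma integrable_variation_zeroAtInfty (μ : ComplexMeasure X) (f : C₀(X, ℂ)) :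
    Integrable f μ.variation :=
  integrable_zeroAtInfty _ f

/-- A complex measure as a functional on `C₀`. -/
def cintegralCLM (μ : ComplexMeasure X) : C₀(X, ℂ) →L[ℂ] ℂ :=
  LinearMap.mkContinuous
    { toFun := fun f ↦ cintegral μ f
      map_add' := fun f g ↦ cintegral_add (integrable_variation_zeroAtInfty μ f)
        (integrable_variation_zeroAtInfty μ g)
      map_smul' := fun c f ↦ cintegral_smul c (integrable_variation_zeroAtInfty μ f) }
    (μ.variation.real Set.univ) fun f ↦ by
      rw [mul_comm]
      exact norm_cintegral_le μ (norm_apply_le_norm f)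

omit [TopologicalSpace X] [BorelSpace X] in
lemma integral_im_eq_zero (p : Measure X) {h : X → ℂ} (him : ∀ x, (h x).im = 0) :
    (∫ x, h x ∂p).im = 0 := by
  have : h = fun x ↦ (((h x).re : ℝ) : ℂ) := funext fun x ↦ Complex.ext rfl (by simp [him x])
  rw [this]
  exact (congrArg Complex.im integral_ofReal).trans (Complex.ofReal_im _)

omit [TopologicalSpace X] [BorelSpace X] in
lemma integral_re_nonneg (p : Measure X) {h : X → ℂ} (hre : ∀ x, 0 ≤ (h x).re)
    (him : ∀ x, (h x).im = 0) : 0 ≤ (∫ x, h x ∂p).re := by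
  have : h = fun x ↦ (((h x).re : ℝ) : ℂ) := funext fun x ↦ Complex.ext rfl (by simp [him x])
  rw [this]
  exact (integral_nonneg hre).trans_eq (congrArg Complex.re integral_ofReal).symm

variable [T2Space X] [LocallyCompactSpace X]

/-- Testing the difference on real functions separates its real and imaginary parts, so in each the
positive and negative Jordan pieces integrate alike. These pieces are regular positive measures,
hence equal, and they cancel. -/
theorem ext_of_cintegral_eq {μ ν : ComplexMeasure X} (hμ : IsRegular μ) (hν : IsRegular ν)
    (h : ∀ f : C₀(X, ℂ), cintegral μ f = cintegral ν f) : μ = ν := by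
  set σ := μ + (-1 : ℂ) • ν with hσdef
  have hσ : IsRegular σ := hμ.add (hν.smul _)
  have h0 : ∀ f : C₀(X, ℂ), cintegral σ f = 0 := fun f ↦ by
    have hi := integrable_variation_zeroAtInfty ν f
    rw [cintegral_add_measure (integrable_variation_zeroAtInfty μ f)
      (integrable_variation_smul hi), cintegral_smul_measure _ hi, h f]
    simp
  have hp := jordanPart_regular hσ
  open scoped CompactlySupported in
  have key : ∀ f : C_c(X, ℝ), ∫ x, f x ∂(jordanPart σ 0) = ∫ x, f x ∂(jordanPart σ 1) ∧
      ∫ x, f x ∂(jordanPart σ 2) = ∫ x, f x ∂(jordanPart σ 3) := fun f ↦ by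
    have hcs : HasCompactSupport fun x ↦ (f x : ℂ) :=
      f.hasCompactSupport.comp_left (g := fun r : ℝ ↦ (r : ℂ)) Complex.ofReal_zero
    have hf := h0 (ofCompactSupport (fun x ↦ (f x : ℂ)) (by fun_prop) hcs)
    rw [cintegral_eq_sum σ fun i ↦ integrable_zeroAtInfty _ _, Fin.sum_univ_four] at hf
    have hr : ∀ i, ∫ x, ofCompactSupport (fun x ↦ (f x : ℂ)) (by fun_prop) hcs x
        ∂(jordanPart σ i) = ((∫ x, f x ∂(jordanPart σ i) : ℝ) : ℂ) := fun i ↦ integral_ofReal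
    rw [hr, hr, hr, hr] at hf
    have hre := congrArg Complex.re hf
    have him := congrArg Complex.im hf
    simp [jordanCoeff] at hre him
    constructor <;> linarith
  have e1 : jordanPart σ 0 = jordanPart σ 1 :=
    Measure.ext_of_integral_eq_on_compactlySupported fun f ↦ (key f).1
  have e2 : jordanPart σ 2 = jordanPart σ 3 :=
    Measure.ext_of_integral_eq_on_compactlySupported fun f ↦ (key f).2
  have hσ0 : σ = 0 := by
    rw [← sum_jordanPart σ, Fin.sum_univ_four]
    simp only [e1, e2, jordanCoeff]
    ext s
    simp
  have : μ - ν = 0 := by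
    rw [← hσ0, hσdef]
    ext s
    simp [sub_eq_add_neg]
  exact sub_eq_zero.1 this

end ZeroAtInfty

/-! ### Convolution of measures and its action on C₀(G) -/

section Group

variable {G : Type*} [TopologicalSpace G] [Group G] [IsTopologicalGroup G]

/-- If |f| ≤ ε off a compact Q, then xK misses Q as soon as x lies outside the compact set QK⁻¹, and
Kx misses Q outside K⁻¹Q. -/
lemma eventually_cocompact_norm_mul_le (f : C₀(G, ℂ)) {K : Set G} (hK : IsCompact K) {ε : ℝ}
    (hε : 0 < ε) :
    (∀ᶠ x in cocompact G, ∀ y ∈ K, ‖f (x * y)‖ ≤ ε) ∧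
      ∀ᶠ x in cocompact G, ∀ y ∈ K, ‖f (y * x)‖ ≤ ε := by
  have h := (f.zero_at_infty').eventually (Metric.closedBall_mem_nhds 0 hε)
  obtain ⟨Q, hQ, hQf⟩ := mem_cocompact.1 h
  have hQf' : ∀ z ∉ Q, ‖f z‖ ≤ ε := fun z hz ↦ by simpa using hQf hz
  constructor
  · refine mem_cocompact.2 ⟨(fun z : G × G ↦ z.1 * z.2⁻¹) '' (Q ×ˢ K),
      (hQ.prod hK).image (by fun_prop), fun x hx y hy ↦ hQf' _ fun hxy ↦ hx ?_⟩
    exact ⟨(x * y, y), ⟨hxy, hy⟩, by simp⟩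
  · refine mem_cocompact.2 ⟨(fun z : G × G ↦ z.2⁻¹ * z.1) '' (Q ×ˢ K),
      (hQ.prod hK).image (by fun_prop), fun x hx y hy ↦ hQf' _ fun hxy ↦ hx ?_⟩
    exact ⟨(y * x, y), ⟨hxy, hy⟩, by simp⟩

lemma continuous_uncurry_mul (f : C₀(G, ℂ)) : Continuous (fun x y ↦ f (x * y)).uncurry :=
  (map_continuous f).comp continuous_mul

lemma continuous_uncurry_mul_swap (f : C₀(G, ℂ)) : Continuous (fun x y ↦ f (y * x)).uncurry :=
  (map_continuous f).comp (continuous_snd.mul continuous_fst)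

/-- The translate `y ↦ f (x y)`. -/
def shift (x : G) (f : C₀(G, ℂ)) : C₀(G, ℂ) :=
  ⟨⟨fun y ↦ f (x * y), by fun_prop⟩,
    f.zero_at_infty'.comp (Homeomorph.mulLeft x).isClosedEmbedding.tendsto_cocompact⟩

variable [T2Space G] [MeasurableSpace G] [BorelSpace G]

/-- The operator `f ↦ (x ↦ ∫ f (x y) dμ(y))` on `C₀(G)`. -/
def convLeft {μ : ComplexMeasure G} (hμ : IsRegular μ) : C₀(G, ℂ) →L[ℂ] C₀(G, ℂ) :=
  LinearMap.mkContinuous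
    { toFun := fun f ↦ ⟨⟨fun x ↦ cintegral μ fun y ↦ f (x * y),
        continuous_cintegral_of_bound hμ (continuous_uncurry_mul f)
          fun x y ↦ norm_apply_le_norm f (x * y)⟩,
        tendsto_cintegral_cocompact_of_bound hμ (continuous_uncurry_mul f)
          (fun x y ↦ norm_apply_le_norm f (x * y))
          fun _ hK _ hε ↦ (eventually_cocompact_norm_mul_le f hK hε).1⟩
      map_add' := fun f g ↦ by
        ext x
        exact map_add (cintegralCLM μ) (shift x f) (shift x g)
      map_smul' := fun c f ↦ by
        ext x
        exact map_smul (cintegralCLM μ) c (shift x f) }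
    (μ.variation.real Set.univ) fun f ↦ by
      refine norm_le_of_forall (by positivity) fun x ↦ ?_
      rw [mul_comm]
      exact norm_cintegral_le μ fun y ↦ norm_apply_le_norm f (x * y)

lemma convLeft_apply {μ : ComplexMeasure G} (hμ : IsRegular μ) (f : C₀(G, ℂ)) (x : G) :
    convLeft hμ f x = cintegral μ fun y ↦ f (x * y) := rfl

lemma norm_convLeft_le {μ : ComplexMeasure G} (hμ : IsRegular μ) :
    ‖convLeft hμ‖ ≤ μ.variation.real Set.univ :=
  LinearMap.mkContinuous_norm_le _ (by positivity) _

/-- The function `y ↦ ∫ f (x y) dμ(x)`. -/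
def convRight {μ : ComplexMeasure G} (hμ : IsRegular μ) (f : C₀(G, ℂ)) : C₀(G, ℂ) :=
  ⟨⟨fun y ↦ cintegral μ fun x ↦ f (x * y),
    continuous_cintegral_of_bound hμ (continuous_uncurry_mul_swap f)
      fun x y ↦ norm_apply_le_norm f (y * x)⟩,
    tendsto_cintegral_cocompact_of_bound hμ (continuous_uncurry_mul_swap f)
      (fun x y ↦ norm_apply_le_norm f (y * x))
      fun _ hK _ hε ↦ (eventually_cocompact_norm_mul_le f hK hε).2⟩

lemma cintegral_eq_convLeft_one {μ : ComplexMeasure G} (hμ : IsRegular μ) (f : C₀(G, ℂ)) :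
    cintegral μ f = convLeft hμ f 1 := by
  simp [convLeft_apply]

lemma convLeft_add {μ ν : ComplexMeasure G} (hμ : IsRegular μ) (hν : IsRegular ν) :
    convLeft (hμ.add hν) = convLeft hμ + convLeft hν := by
  ext f x
  exact cintegral_add_measure (integrable_variation_zeroAtInfty μ (shift x f))
    (integrable_variation_zeroAtInfty ν (shift x f))

lemma convLeft_smul {μ : ComplexMeasure G} (hμ : IsRegular μ) (c : ℂ) :
    convLeft (hμ.smul c) = c • convLeft hμ := by
  ext f x
  exact cintegral_smul_measure c (integrable_variation_zeroAtInfty μ (shift x f))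

omit [IsTopologicalGroup G] in
lemma isRegular_deltaOne : IsRegular (deltaOne G) := isRegular_dirac 1

lemma convLeft_deltaOne : convLeft (isRegular_deltaOne (G := G)) = 1 := by
  ext f x
  rw [convLeft_apply, deltaOne, cintegral_dirac, mul_one]
  rfl

variable [LocallyCompactSpace G]

/-- Fubini exhibits `convRight` as the pre-adjoint of ν ↦ μ*ν, just as `convLeft` is that of μ ↦
μ*ν. Separate weak* continuity of convolution rests on these two facts. -/
lemma cintegral_convLeft {μ ν : ComplexMeasure G} (hμ : IsRegular μ) (hν : IsRegular ν)
    (f : C₀(G, ℂ)) : cintegral μ (convLeft hν f) = cintegral ν (convRight hμ f) :=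
  cintegral_cintegral_swap hμ hν (continuous_uncurry_mul f)
    fun x y ↦ norm_apply_le_norm f (x * y)

/-- For a pair of positive Jordan pieces the iterated integral is a positive functional, so Riesz
gives a measure; the sixteen measures are recombined with the products of the coefficients. -/
lemma exists_isConv {μ ν : ComplexMeasure G} (hμ : IsRegular μ) (hν : IsRegular ν) :
    ∃ ρ, IsConv μ ν ρ := by
  have hp := jordanPart_regular hμ
  have hq := jordanPart_regular hν
  have hL : ∀ (j : Fin 4) (f : C₀(G, ℂ)) (x : G),
      convLeft (isRegular_ofMeasure (jordanPart ν j)) f x = ∫ y, f (x * y) ∂(jordanPart ν j) :=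
    fun j f x ↦ cintegral_ofMeasure _ (integrable_zeroAtInfty _ (shift x f))
  have hex : ∀ ij : Fin 4 × Fin 4, ∃ r : Measure G, IsFiniteMeasure r ∧ r.Regular ∧
      ∀ f : C₀(G, ℂ), ∫ x, ∫ y, f (x * y) ∂(jordanPart ν ij.2) ∂(jordanPart μ ij.1) =
        ∫ x, f x ∂r := fun ij ↦ by
    obtain ⟨r, h1, h2, h3⟩ := exists_measure_of_positive
      ((integralCLM (jordanPart μ ij.1)).comp
        (convLeft (isRegular_ofMeasure (jordanPart ν ij.2))))
      (fun f hf ↦ integral_im_eq_zero _ fun x ↦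
        (congrArg Complex.im (hL _ f x)).trans (integral_im_eq_zero _ fun y ↦ hf _))
      (fun f hre him ↦ integral_re_nonneg _
        (fun x ↦ (integral_re_nonneg _ (fun y ↦ hre _) fun y ↦ him _).trans_eq
          (congrArg Complex.re (hL _ f x)).symm)
        (fun x ↦ (congrArg Complex.im (hL _ f x)).trans (integral_im_eq_zero _ fun y ↦ him _)))
    refine ⟨r, h1, h2, fun f ↦ ?_⟩
    rw [← h3 f]
    simp_rw [← hL]
    rfl
  choose r hfin hreg hr using hex
  refine ⟨∑ ij, (jordanCoeff ij.1 * jordanCoeff ij.2) • ofMeasure (r ij),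
    isRegular_sum _ fun ij ↦ (isRegular_ofMeasure (r ij)).smul _, fun f ↦ ?_⟩
  rw [cintegral_sum_ofMeasure _ _ _ fun ij ↦ integrable_zeroAtInfty _ f,
    cintegral_cintegral_eq_sum μ hν (continuous_uncurry_mul f)
      fun x y ↦ norm_apply_le_norm f (x * y), Fintype.sum_prod_type]
  simp only [← hr (_, _)]

lemma isConv_conv {μ ν : ComplexMeasure G} (hμ : IsRegular μ) (hν : IsRegular ν) :
    IsConv μ ν (conv μ ν) := by
  have h := exists_isConv hμ hν
  rw [conv, dif_pos h]
  exact h.choose_spec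

lemma IsRegular.conv {μ ν : ComplexMeasure G} (hμ : IsRegular μ) (hν : IsRegular ν) :
    IsRegular (conv μ ν) :=
  (isConv_conv hμ hν).1

lemma cintegral_conv {μ ν : ComplexMeasure G} (hμ : IsRegular μ) (hν : IsRegular ν)
    (f : C₀(G, ℂ)) : cintegral (conv μ ν) f = cintegral μ (convLeft hν f) :=
  (isConv_conv hμ hν).2 f

lemma convLeft_conv {μ ν : ComplexMeasure G} (hμ : IsRegular μ) (hν : IsRegular ν) :
    convLeft (hμ.conv hν) = convLeft hμ * convLeft hν := by
  ext f x
  refine (cintegral_conv hμ hν (shift x f)).trans ?_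
  change cintegral μ (fun y ↦ cintegral ν fun z ↦ f (x * (y * z))) =
    cintegral μ (fun y ↦ cintegral ν fun z ↦ f (x * y * z))
  simp_rw [mul_assoc]

lemma IsRegular.convPow {μ : ComplexMeasure G} (hμ : IsRegular μ) :
    ∀ n, IsRegular (convPow μ n)
  | 0 => isRegular_deltaOne
  | n + 1 => hμ.conv (hμ.convPow n)

lemma convLeft_convPow {μ : ComplexMeasure G} (hμ : IsRegular μ) :
    ∀ n, convLeft (hμ.convPow n) = convLeft hμ ^ n
  | 0 => by
    rw [pow_zero]
    exact convLeft_deltaOne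
  | n + 1 => by
    rw [pow_succ', ← convLeft_convPow hμ n]
    exact convLeft_conv hμ (hμ.convPow n)

lemma ext_of_convLeft_eq {μ ν : ComplexMeasure G} (hμ : IsRegular μ) (hν : IsRegular ν)
    (h : convLeft hμ = convLeft hν) : μ = ν :=
  ext_of_cintegral_eq hμ hν fun f ↦ by
    rw [cintegral_eq_convLeft_one hμ, cintegral_eq_convLeft_one hν, h]

end Group

end MeasAlg

end

noncomputable section

namespace MeasAlg

/-! ### Binomial moments and the decay of T^n(1 - T) -/

section Binomial

/-- The variance identity for Bernstein polynomials at 1/2, multiplied by 4 · 2^N. -/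
lemma sum_sq_mul_choose (N : ℕ) :
    ∑ k ∈ Finset.range (N + 1), ((N : ℝ) - 2 * k) ^ 2 * (N.choose k : ℝ) = (N : ℝ) * 2 ^ N := by
  have h := congrArg (Polynomial.eval (1 / 2 : ℝ)) (bernsteinPolynomial.variance ℝ N)
  simp only [bernsteinPolynomial, Polynomial.eval_finsetSum, Polynomial.eval_mul,
    Polynomial.eval_pow, Polynomial.eval_sub, Polynomial.eval_natCast, Polynomial.eval_X,
    Polynomial.eval_one, nsmul_eq_mul] at h
  have h2 : ∀ k ∈ Finset.range (N + 1), ((N : ℝ) - 2 * k) ^ 2 * (N.choose k : ℝ) =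
      4 * 2 ^ N * (((N : ℝ) * (1 / 2) - k) ^ 2 *
        (N.choose k * (1 / 2) ^ k * (1 - 1 / 2) ^ (N - k))) := fun k hk ↦ by
    have hk' : k ≤ N := Nat.lt_succ_iff.1 (Finset.mem_range.1 hk)
    have e : (2 : ℝ) ^ N * ((1 / 2) ^ k * (1 - 1 / 2) ^ (N - k)) = 1 := by
      rw [show (1 - 1 / 2 : ℝ) = 1 / 2 by norm_num, ← pow_add, Nat.add_sub_cancel' hk', ← mul_pow]
      norm_num
    linear_combination (-((N : ℝ) - 2 * k) ^ 2 * N.choose k) * e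
  rw [Finset.sum_congr rfl h2, ← Finset.mul_sum, h]
  ring

lemma sum_choose_real (N : ℕ) :
    ∑ k ∈ Finset.range (N + 1), (N.choose k : ℝ) = 2 ^ N := by
  exact_mod_cast Nat.sum_range_choose N

lemma sum_abs_mul_choose_le {N : ℕ} (hN : 0 < N) :
    ∑ k ∈ Finset.range (N + 1), |(N : ℝ) - 2 * k| * (N.choose k : ℝ) ≤ √(N : ℝ) * 2 ^ N := by
  have hs : 0 < √(N : ℝ) := Real.sqrt_pos.2 (by exact_mod_cast hN)
  have hss : √(N : ℝ) * √(N : ℝ) = N := Real.mul_self_sqrt (by positivity)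
  have h1 : ∀ k ∈ Finset.range (N + 1), |(N : ℝ) - 2 * k| * (N.choose k : ℝ) ≤
      (1 / (2 * √(N : ℝ))) * (((N : ℝ) - 2 * k) ^ 2 * (N.choose k : ℝ)) +
        √(N : ℝ) / 2 * (N.choose k : ℝ) := fun k _ ↦ by
    -- The inequality 2ab ≤ a² + b² with b = √N stands in for Cauchy–Schwarz; the two terms on the
    -- right contribute equally after summation.
    have h2 : |(N : ℝ) - 2 * k| ≤ (1 / (2 * √(N : ℝ))) * ((N : ℝ) - 2 * k) ^ 2 + √(N : ℝ) / 2 := by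
      rw [← sub_nonneg]
      have : (1 / (2 * √(N : ℝ))) * ((N : ℝ) - 2 * k) ^ 2 + √(N : ℝ) / 2 - |(N : ℝ) - 2 * k| =
          (|(N : ℝ) - 2 * k| - √(N : ℝ)) ^ 2 / (2 * √(N : ℝ)) := by
        rw [← sq_abs ((N : ℝ) - 2 * k)]
        generalize |(N : ℝ) - 2 * k| = a
        field_simp
        ring
      rw [this]
      positivity
    have := mul_le_mul_of_nonneg_right h2 (Nat.cast_nonneg (α := ℝ) (N.choose k))
    linarith
  refine (Finset.sum_le_sum h1).trans (le_of_eq ?_)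
  rw [Finset.sum_add_distrib, ← Finset.mul_sum, ← Finset.mul_sum, sum_sq_mul_choose,
    sum_choose_real]
  have : 1 / (2 * √(N : ℝ)) * (N * 2 ^ N) = √(N : ℝ) / 2 * 2 ^ N := by
    nth_rewrite 2 [← hss]
    field_simp
  rw [this]
  ring

end Binomial

section Algebra

variable {A : Type*} [Ring A] [Algebra ℂ A]

lemma one_add_pow_eq_sum (S : A) (n : ℕ) :
    (1 + S) ^ n = ∑ k ∈ Finset.range (n + 1), (n.choose k : ℂ) • S ^ k := by
  rw [add_comm, (Commute.one_right S).add_pow]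
  refine Finset.sum_congr rfl fun k _ ↦ ?_
  rw [one_pow, mul_one, Nat.cast_smul_eq_nsmul, nsmul_eq_mul, Nat.cast_comm]

lemma half_smul_pow_eq_sum (S : A) (n : ℕ) :
    ((1 / 2 : ℂ) • (1 + S)) ^ n =
      ∑ k ∈ Finset.range (n + 1), ((1 / 2 : ℂ) ^ n * n.choose k) • S ^ k := by
  rw [smul_pow, one_add_pow_eq_sum, Finset.smul_sum]
  simp only [smul_smul]

/-- Write 1 - S = (1 + S) - 2S and use (n+1) S(1+S)^n = ∑ k C(n+1,k) S^k. The factor n+1 avoids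
division, and the coefficients are those of the first absolute moment for N = n+1. -/
lemma smul_one_add_pow_mul_one_sub (S : A) (n : ℕ) :
    ((n + 1 : ℕ) : ℂ) • ((1 + S) ^ n * (1 - S)) = ∑ k ∈ Finset.range (n + 2),
      (((((n + 1 : ℕ) : ℝ) - 2 * k) * (n + 1).choose k : ℝ) : ℂ) • S ^ k := by
  have h1 : ((n + 1 : ℕ) : ℂ) • (S * (1 + S) ^ n) =
      ∑ k ∈ Finset.range (n + 2), ((k : ℂ) * (n + 1).choose k) • S ^ k := by
    rw [Finset.sum_range_succ', one_add_pow_eq_sum, Finset.mul_sum, Finset.smul_sum]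
    simp only [Nat.cast_zero, zero_mul, zero_smul, add_zero]
    refine Finset.sum_congr rfl fun k _ ↦ ?_
    rw [mul_smul_comm, smul_smul, pow_succ']
    congr 1
    have := Nat.add_one_mul_choose_eq n k
    rw [mul_comm ((k + 1 : ℕ) : ℂ)]
    exact_mod_cast this
  have hc : Commute S ((1 + S) ^ n) := ((Commute.one_right S).add_right (Commute.refl S)).pow_right n
  have h2 : ((n + 1 : ℕ) : ℂ) • ((1 + S) ^ n * (1 - S)) =
      ((n + 1 : ℕ) : ℂ) • (1 + S) ^ (n + 1) - (2 : ℂ) • (((n + 1 : ℕ) : ℂ) • (S * (1 + S) ^ n)) := by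
    rw [smul_comm (2 : ℂ), ← smul_sub, hc.eq, two_smul, pow_succ]
    congr 1
    noncomm_ring
  rw [h2, h1, one_add_pow_eq_sum, Finset.smul_sum, Finset.smul_sum, ← Finset.sum_sub_distrib]
  refine Finset.sum_congr rfl fun k _ ↦ ?_
  rw [smul_smul, smul_smul, ← sub_smul]
  congr 1
  push_cast
  ring

end Algebra

section PowerBoundedMean

variable {A : Type*} [NormedRing A] [NormedAlgebra ℂ A]

lemma norm_half_smul_pow_le {S : A} {C : ℝ} (hC : ∀ k, ‖S ^ k‖ ≤ C) (n : ℕ) :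
    ‖((1 / 2 : ℂ) • (1 + S)) ^ n‖ ≤ C := by
  rw [half_smul_pow_eq_sum]
  calc _ ≤ ∑ k ∈ Finset.range (n + 1), ((1 / 2 : ℝ) ^ n * n.choose k) * C := by
        refine norm_sum_le_of_le _ fun k _ ↦ ?_
        rw [norm_smul]
        simp only [norm_mul, norm_pow, norm_div, norm_one, Complex.norm_ofNat, Complex.norm_natCast]
        gcongr
        exact hC k
    _ = C := by
        rw [← Finset.sum_mul, ← Finset.mul_sum, sum_choose_real, ← mul_pow]
        norm_num

/-- With T = (1+S)/2 one has T^n(1 - T) = 2^(-(n+1)) (1+S)^n (1 - S), and the first absolute moment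
bounds its norm by C/√(n+1). -/
theorem tendsto_half_smul_pow_mul {S : A} {C : ℝ} (hC : ∀ k, ‖S ^ k‖ ≤ C) :
    Tendsto (fun n : ℕ ↦ ((1 / 2 : ℂ) • (1 + S)) ^ n * (1 - (1 / 2 : ℂ) • (1 + S))) atTop
      (𝓝 0) := by
  have hC0 : 0 ≤ C := (norm_nonneg _).trans (hC 0)
  have hT : ∀ n : ℕ, ((1 / 2 : ℂ) • (1 + S)) ^ n * (1 - (1 / 2 : ℂ) • (1 + S)) =
      (((1 / 2 : ℂ) ^ (n + 1)) * (((n + 1 : ℕ) : ℂ))⁻¹) •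
        (((n + 1 : ℕ) : ℂ) • ((1 + S) ^ n * (1 - S))) := fun n ↦ by
    have h1 : (1 : A) - (1 / 2 : ℂ) • (1 + S) = (1 / 2 : ℂ) • (1 - S) := by
      have : (1 : A) = (1 / 2 : ℂ) • (1 : A) + (1 / 2 : ℂ) • (1 : A) := by
        rw [← add_smul]; norm_num
      nth_rewrite 1 [this]
      rw [smul_add, smul_sub]
      abel
    have hn : ((n + 1 : ℕ) : ℂ) ≠ 0 := by exact_mod_cast Nat.succ_ne_zero n
    rw [h1, smul_pow, smul_mul_smul_comm, smul_smul, ← pow_succ, mul_assoc, inv_mul_cancel₀ hn,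
      mul_one]
  have hb : ∀ n : ℕ, ‖((1 / 2 : ℂ) • (1 + S)) ^ n * (1 - (1 / 2 : ℂ) • (1 + S))‖ ≤
      C * (√((n + 1 : ℕ) : ℝ))⁻¹ := fun n ↦ by
    rw [hT, smul_one_add_pow_mul_one_sub, norm_smul]
    have hs : 0 < √((n + 1 : ℕ) : ℝ) := Real.sqrt_pos.2 (by positivity)
    have hss : √((n + 1 : ℕ) : ℝ) * √((n + 1 : ℕ) : ℝ) = ((n + 1 : ℕ) : ℝ) :=
      Real.mul_self_sqrt (by positivity)
    have h1 : ‖∑ k ∈ Finset.range (n + 2),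
        (((((n + 1 : ℕ) : ℝ) - 2 * k) * (n + 1).choose k : ℝ) : ℂ) • S ^ k‖ ≤
        √((n + 1 : ℕ) : ℝ) * 2 ^ (n + 1) * C := by
      refine (norm_sum_le_of_le (f := fun k ↦ _) (n := fun k : ℕ ↦
        (|((n + 1 : ℕ) : ℝ) - 2 * k| * (n + 1).choose k) * C) _ fun k _ ↦ ?_).trans ?_
      · rw [norm_smul, Complex.norm_real, Real.norm_eq_abs, abs_mul, Nat.abs_cast]
        gcongr
        exact hC k
      · rw [← Finset.sum_mul]
        gcongr
        exact sum_abs_mul_choose_le (Nat.succ_pos n)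
    refine (mul_le_mul_of_nonneg_left h1 (norm_nonneg _)).trans (le_of_eq ?_)
    simp only [norm_mul, norm_pow, norm_div, norm_one, Complex.norm_ofNat, norm_inv,
      Complex.norm_natCast]
    have h2 : (1 / 2 : ℝ) ^ (n + 1) * 2 ^ (n + 1) = 1 := by rw [← mul_pow]; norm_num
    have h3 : (((n + 1 : ℕ) : ℝ))⁻¹ * √((n + 1 : ℕ) : ℝ) = (√((n + 1 : ℕ) : ℝ))⁻¹ := by
      nth_rewrite 1 [← hss]
      field_simp
    linear_combination ((((n + 1 : ℕ) : ℝ))⁻¹ * √((n + 1 : ℕ) : ℝ) * C) * h2 + C * h3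
  refine squeeze_zero_norm hb ?_
  have h1 : Tendsto (fun n : ℕ ↦ √((n + 1 : ℕ) : ℝ)) atTop atTop :=
    Real.tendsto_sqrt_atTop.comp (tendsto_natCast_atTop_atTop.comp (tendsto_add_atTop_nat 1))
  simpa using (tendsto_inv_atTop_zero.comp h1).const_mul C

end PowerBoundedMean

/-! ### From weak to strong convergence of powers -/

section WeakStrong

variable {E : Type*} [NormedAddCommGroup E] [NormedSpace ℂ E]

/-- A functional that kills the range of 1 - T is constant along the orbit of f, so it takes the
same value at f and at the weak limit g. By Hahn–Banach f - g lies in the closure of that range,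
where T^n tends to 0 pointwise. -/
theorem tendsto_pow_of_weak {T : E →L[ℂ] E} {C : ℝ} (hC : ∀ n, ‖T ^ n‖ ≤ C)
    (hT : Tendsto (fun n ↦ T ^ n * (1 - T)) atTop (𝓝 0)) {f g : E} (hg : T g = g)
    (hw : ∀ φ : E →L[ℂ] ℂ, Tendsto (fun n ↦ φ ((T ^ n) f)) atTop (𝓝 (φ g))) :
    Tendsto (fun n ↦ (T ^ n) f) atTop (𝓝 g) := by
  have hC0 : 0 ≤ C := (norm_nonneg _).trans (hC 0)
  set M : Submodule ℂ E := (1 - T : E →L[ℂ] E).range.topologicalClosure with hM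
  have hmem : f - g ∈ M := by
    by_contra hnot
    -- A norming functional of the class of f - g in the quotient by the closed subspace M.
    obtain ⟨φ, hφ, hφM⟩ : ∃ φ : E →L[ℂ] ℂ, φ (f - g) ≠ 0 ∧ ∀ y ∈ M, φ y = 0 := by
      have hcl : IsClosed (M : Set E) := Submodule.isClosed_topologicalClosure _
      have hne : M.mkQ (f - g) ≠ 0 :=
        (Submodule.Quotient.mk_eq_zero M).not.2 hnot
      obtain ⟨ψ, -, hψ⟩ := exists_dual_vector ℂ (M.mkQ (f - g)) (norm_ne_zero_iff.2 hne)
      refine ⟨ψ.comp M.mkQL, ?_, fun y hy ↦ ?_⟩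
      · change ψ (M.mkQ (f - g)) ≠ 0
        rw [hψ]
        exact Complex.ofReal_ne_zero.2 (norm_ne_zero_iff.2 hne)
      · exact (congrArg ψ ((Submodule.Quotient.mk_eq_zero M).2 hy)).trans (map_zero ψ)
    have hconst : ∀ n, φ ((T ^ n) f) = φ f := fun n ↦ by
      have h1 : f - (T ^ n) f ∈ M := by
        refine Submodule.le_topologicalClosure _ ⟨(∑ i ∈ Finset.range n, T ^ i) f, ?_⟩
        exact congrArg (fun R : E →L[ℂ] E ↦ R f) (mul_neg_geom_sum T n)
      have h2 := hφM _ h1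
      rw [map_sub, sub_eq_zero] at h2
      exact h2.symm
    have h3 := hw φ
    simp only [hconst] at h3
    exact hφ (by rw [map_sub, tendsto_nhds_unique h3 tendsto_const_nhds, sub_self])
  have hfix : ∀ n, (T ^ n) g = g := fun n ↦ by
    induction n with
    | zero => simp
    | succ n ih => rw [pow_succ, mul_apply_eq_comp, hg, ih]
  rw [tendsto_iff_norm_sub_tendsto_zero, Metric.tendsto_atTop]
  intro ε hε
  obtain ⟨_, ⟨u, rfl⟩, hu⟩ := Metric.mem_closure_iff.1 hmem (ε / (2 * (C + 1))) (by positivity)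
  have h1 : Tendsto (fun n ↦ ‖(T ^ n * (1 - T) : E →L[ℂ] E) u‖) atTop (𝓝 0) := by
    refine squeeze_zero (fun _ ↦ norm_nonneg _) (fun n ↦ (T ^ n * (1 - T)).le_opNorm u) ?_
    simpa using hT.norm.mul_const ‖u‖
  obtain ⟨N, hN⟩ := Metric.tendsto_atTop.1 h1 (ε / 2) (by positivity)
  refine ⟨N, fun n hn ↦ ?_⟩
  have h2 := hN n hn
  simp only [dist_zero_right, norm_norm] at h2 ⊢
  have hu' : ‖f - g - (1 - T : E →L[ℂ] E) u‖ < ε / (2 * (C + 1)) := by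
    rw [← dist_eq_norm]
    exact hu
  have h3 : (T ^ n) f - g = (T ^ n) (f - g - (1 - T : E →L[ℂ] E) u) + (T ^ n * (1 - T) : E →L[ℂ] E) u := by
    rw [mul_apply_eq_comp, ← map_add, sub_add_cancel, map_sub, hfix]
  have h4 : ‖(T ^ n) (f - g - (1 - T : E →L[ℂ] E) u)‖ ≤ C * (ε / (2 * (C + 1))) :=
    ((T ^ n).le_opNorm _).trans (mul_le_mul (hC n) hu'.le (norm_nonneg _) hC0)
  have h5 : C * (ε / (2 * (C + 1))) ≤ ε / 2 := by
    rw [mul_div_assoc', div_le_div_iff₀ (by positivity) (by norm_num)]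
    nlinarith
  rw [h3]
  exact (norm_add_le _ _).trans_lt (by linarith)

end WeakStrong

/-! ### Weak* compactness of bounded sets of measures -/

section UltrafilterLimit

lemma exists_tendsto_ultrafilter {ι : Type*} (U : Ultrafilter ι) {a : ι → ℂ} {r : ℝ}
    (ha : ∀ n, ‖a n‖ ≤ r) : ∃ z, ‖z‖ ≤ r ∧ Tendsto a U (𝓝 z) := by
  obtain ⟨z, hz, hle⟩ := (isCompact_closedBall (0 : ℂ) r).ultrafilter_le_nhds (U.map a)
    (by
      rw [le_principal_iff]
      exact Filter.mem_map.2 (Filter.univ_mem' fun n ↦ by simpa using ha n))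
  exact ⟨z, by simpa using hz, hle⟩

variable {X : Type*} [TopologicalSpace X] [T2Space X] [LocallyCompactSpace X] [MeasurableSpace X]
  [BorelSpace X]

lemma exists_measure_ultrafilter_limit {ι : Type*} (U : Ultrafilter ι) (p : ι → Measure X)
    [∀ n, IsFiniteMeasure (p n)] {C : ℝ} (hC : ∀ n, (p n).real Set.univ ≤ C) :
    ∃ q : Measure X, IsFiniteMeasure q ∧ q.Regular ∧
      ∀ f : C₀(X, ℂ), Tendsto (fun n ↦ ∫ x, f x ∂(p n)) U (𝓝 (∫ x, f x ∂q)) := by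
  have hb : ∀ (f : C₀(X, ℂ)) n, ‖∫ x, f x ∂(p n)‖ ≤ C * ‖f‖ := fun f n ↦
    (norm_integral_le_of_norm_le_const (Eventually.of_forall (norm_apply_le_norm f))).trans (by
      rw [mul_comm]
      exact mul_le_mul_of_nonneg_right (hC n) (norm_nonneg _))
  choose Λ hΛb hΛ using fun f : C₀(X, ℂ) ↦ exists_tendsto_ultrafilter U (hb f)
  let L : C₀(X, ℂ) →L[ℂ] ℂ := LinearMap.mkContinuous
    { toFun := Λ
      map_add' := fun f g ↦ tendsto_nhds_unique (hΛ (f + g))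
        (((hΛ f).add (hΛ g)).congr fun n ↦ (map_add (integralCLM (p n)) f g).symm)
      map_smul' := fun c f ↦ tendsto_nhds_unique (hΛ (c • f))
        (((hΛ f).const_smul c).congr fun n ↦ (map_smul (integralCLM (p n)) c f).symm) }
    C hΛb
  obtain ⟨q, h1, h2, h3⟩ := exists_measure_of_positive L
    (fun f hf ↦ tendsto_nhds_unique ((Complex.continuous_im.tendsto _).comp (hΛ f))
      (tendsto_const_nhds.congr fun n ↦ (integral_im_eq_zero (p n) hf).symm))
    (fun f hre him ↦ ge_of_tendsto' ((Complex.continuous_re.tendsto _).comp (hΛ f))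
      fun n ↦ integral_re_nonneg (p n) hre him)
  exact ⟨q, h1, h2, fun f ↦ h3 f ▸ hΛ f⟩

/-- Limits are taken for each Jordan piece separately: positivity survives the limit, so the Riesz
theorem is needed for positive functionals only. -/
theorem exists_ultrafilter_limit {ι : Type*} (U : Ultrafilter ι) (ρ : ι → ComplexMeasure X)
    {C : ℝ} (hC : ∀ n, (ρ n).variation.real Set.univ ≤ C) :
    ∃ θ : ComplexMeasure X, IsRegular θ ∧
      ∀ f : C₀(X, ℂ), Tendsto (fun n ↦ cintegral (ρ n) f) U (𝓝 (cintegral θ f)) := by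
  choose q h1 h2 h3 using fun i : Fin 4 ↦ exists_measure_ultrafilter_limit U
    (fun n ↦ jordanPart (ρ n) i) (C := C) fun n ↦
      (ENNReal.toReal_mono (measure_ne_top _ _) (jordanPart_le_variation (ρ n) i _)).trans (hC n)
  refine ⟨∑ i, jordanCoeff i • ofMeasure (q i),
    isRegular_sum _ fun i ↦ (isRegular_ofMeasure (q i)).smul _, fun f ↦ ?_⟩
  rw [cintegral_sum_ofMeasure _ _ _ fun i ↦ integrable_zeroAtInfty _ f]
  simp_rw [fun n ↦ cintegral_eq_sum (ρ n) fun i ↦ integrable_zeroAtInfty _ f]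
  exact tendsto_finsetSum _ fun i _ ↦ (h3 i f).const_smul (jordanCoeff i)

end UltrafilterLimit

end MeasAlg

end

noncomputable section

namespace MeasAlg

/-! ### Weak* convergence of the powers of (δ_e + μ)/2 -/

section WeakStar

lemma tendsto_pow_sub_pow_succ {E : Type*} [NormedAddCommGroup E] [NormedSpace ℂ E]
    {T : E →L[ℂ] E} (hT : Tendsto (fun n ↦ T ^ n * (1 - T)) atTop (𝓝 0)) (f : E) :
    Tendsto (fun n ↦ (T ^ n) f - (T ^ (n + 1)) f) atTop (𝓝 0) := by
  have h : Tendsto (fun n ↦ (T ^ n * (1 - T) : E →L[ℂ] E) f) atTop (𝓝 0) :=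
    ((ContinuousLinearMap.apply ℂ E f).continuous.tendsto 0).comp hT
  refine h.congr fun n ↦ ?_
  rw [mul_sub, mul_one, ← pow_succ]
  rfl

variable {G : Type*} [TopologicalSpace G] [Group G] [IsTopologicalGroup G] [T2Space G]
  [MeasurableSpace G] [BorelSpace G]

lemma shift_convLeft {μ : ComplexMeasure G} (hμ : IsRegular μ) (x : G) (f : C₀(G, ℂ)) :
    shift x (convLeft hμ f) = convLeft hμ (shift x f) := by
  ext y
  change cintegral μ (fun z ↦ f (x * y * z)) = cintegral μ (fun z ↦ f (x * (y * z)))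
  simp_rw [mul_assoc]

lemma convLeft_apply_shift {μ : ComplexMeasure G} (hμ : IsRegular μ) (x : G) (f : C₀(G, ℂ)) :
    convLeft hμ f x = cintegral μ (shift x f) := rfl

/-- The mean `(δ_e + μ) / 2`. -/
def halfMean (μ : ComplexMeasure G) : ComplexMeasure G := (1 / 2 : ℂ) • (deltaOne G + μ)

omit [IsTopologicalGroup G] in
lemma IsRegular.halfMean {μ : ComplexMeasure G} (hμ : IsRegular μ) : IsRegular (halfMean μ) :=
  (isRegular_deltaOne.add hμ).smul _

lemma convLeft_halfMean {μ : ComplexMeasure G} (hμ : IsRegular μ) :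
    convLeft hμ.halfMean = (1 / 2 : ℂ) • (1 + convLeft hμ) := by
  rw [← convLeft_deltaOne, ← convLeft_add isRegular_deltaOne hμ]
  exact convLeft_smul (isRegular_deltaOne.add hμ) _

variable [LocallyCompactSpace G]

/-- The binomial formula is transported from operators to measures, since the compactness argument
needs a bound on total variation and not only on operator norms. -/
lemma convPow_halfMean_eq_sum {μ : ComplexMeasure G} (hμ : IsRegular μ) (n : ℕ) :
    convPow (halfMean μ) n =
      ∑ k ∈ Finset.range (n + 1), ((1 / 2 : ℂ) ^ n * n.choose k) • convPow μ k := by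
  refine ext_of_cintegral_eq (hμ.halfMean.convPow n)
    (isRegular_sum _ fun k ↦ (hμ.convPow k).smul _) fun f ↦ ?_
  have h1 : cintegral (∑ k ∈ Finset.range (n + 1), ((1 / 2 : ℂ) ^ n * n.choose k) • convPow μ k) f =
      ∑ k ∈ Finset.range (n + 1), ((1 / 2 : ℂ) ^ n * n.choose k) • cintegral (convPow μ k) f :=
    (VectorMeasure.integral_finsetSum_vectorMeasure fun k _ ↦
      integrable_variation_zeroAtInfty _ f).trans (Finset.sum_congr rfl fun k _ ↦
        cintegral_smul_measure _ (integrable_variation_zeroAtInfty _ f))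
  rw [h1, cintegral_eq_convLeft_one (hμ.halfMean.convPow n), convLeft_convPow hμ.halfMean,
    convLeft_halfMean hμ, half_smul_pow_eq_sum (A := C₀(G, ℂ) →L[ℂ] C₀(G, ℂ)) (convLeft hμ) n]
  have h2 : ∀ k, cintegral (convPow μ k) f = (convLeft hμ ^ k) f 1 := fun k ↦ by
    rw [cintegral_eq_convLeft_one (hμ.convPow k), convLeft_convPow]
  simp only [h2]
  rw [sum_apply]
  have h3 : ∀ (s : Finset ℕ) (g : ℕ → C₀(G, ℂ)), (∑ k ∈ s, g k) 1 = ∑ k ∈ s, g k 1 :=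
    fun s g ↦ by
      classical
      induction s using Finset.induction_on with
      | empty => rfl
      | insert a s ha ih =>
        rw [Finset.sum_insert ha, Finset.sum_insert ha, ZeroAtInftyContinuousMap.add_apply, ih]
  rw [h3]
  rfl

omit [IsTopologicalGroup G] [T2Space G] [BorelSpace G] [LocallyCompactSpace G] in
lemma PowerBounded.exists_bound {μ : ComplexMeasure G} (h : PowerBounded μ) :
    ∃ C : ℝ, ∀ n, (convPow μ n).variation.real Set.univ ≤ C :=
  ⟨(⨆ n, tvNorm (convPow μ n)).toReal, fun n ↦
    ENNReal.toReal_mono h.ne (le_iSup (fun n ↦ tvNorm (convPow μ n)) n)⟩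

lemma variation_convPow_halfMean_le {μ : ComplexMeasure G} (hμ : IsRegular μ) {C : ℝ}
    (hC : ∀ n, (convPow μ n).variation.real Set.univ ≤ C) (n : ℕ) :
    (convPow (halfMean μ) n).variation.real Set.univ ≤ C := by
  have hb : ∀ (s : Finset ℕ) (c : ℕ → ℂ),
      (∑ k ∈ s, c k • convPow μ k).variation.real Set.univ ≤ ∑ k ∈ s, ‖c k‖ * C := fun s c ↦ by
    classical
    induction s using Finset.induction_on with
    | empty => simp
    | insert a s ha ih =>
      rw [Finset.sum_insert ha, Finset.sum_insert ha]
      have h1 : (c a • convPow μ a).variation.real Set.univ =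
          ‖c a‖ * (convPow μ a).variation.real Set.univ := by
        rw [variation_smul_complex]
        simp [Measure.real, Measure.smul_apply]
      have h2 := ENNReal.toReal_mono (measure_ne_top
        ((c a • convPow μ a).variation + (∑ k ∈ s, c k • convPow μ k).variation) _)
        (VectorMeasure.variation_add_le (μ := c a • convPow μ a)
          (ν := ∑ k ∈ s, c k • convPow μ k) Set.univ)
      have h3 := measureReal_add_apply (μ₁ := (c a • convPow μ a).variation)
        (μ₂ := (∑ k ∈ s, c k • convPow μ k).variation) (s := Set.univ)
      have h4 := mul_le_mul_of_nonneg_left (hC a) (norm_nonneg (c a))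
      calc _ ≤ _ := h2
        _ = _ := h3
        _ ≤ _ := add_le_add (h1.le.trans h4) ih
  rw [convPow_halfMean_eq_sum hμ]
  refine (hb _ _).trans (le_of_eq ?_)
  simp only [norm_mul, norm_pow, norm_div, norm_one, Complex.norm_ofNat, Complex.norm_natCast]
  rw [← Finset.sum_mul, ← Finset.mul_sum, sum_choose_real, ← mul_pow]
  norm_num

section Limits

variable {ν θ : ComplexMeasure G} (hν : IsRegular ν) (hθ : IsRegular θ) {U : Ultrafilter ℕ}

lemma cintegral_convPow (n : ℕ) (f : C₀(G, ℂ)) :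
    cintegral (convPow ν n) f = (convLeft hν ^ n) f 1 := by
  rw [cintegral_eq_convLeft_one (hν.convPow n), convLeft_convPow hν]

include hν in
lemma tendsto_convLeft_pow_succ (hU : (U : Filter ℕ) ≤ atTop)
    (hT : Tendsto (fun n ↦ convLeft hν ^ n * (1 - convLeft hν)) atTop (𝓝 0))
    (hlim : ∀ f : C₀(G, ℂ), Tendsto (fun n ↦ cintegral (convPow ν n) f) U (𝓝 (cintegral θ f)))
    (f : C₀(G, ℂ)) :
    Tendsto (fun n ↦ (convLeft hν ^ (n + 1)) f 1) U (𝓝 (cintegral θ f)) := by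
  have h1 : Tendsto (fun n ↦ ((convLeft hν ^ n) f - (convLeft hν ^ (n + 1)) f) 1) U (𝓝 0) :=
    squeeze_zero_norm (fun n ↦ norm_apply_le_norm _ 1)
      (tendsto_zero_iff_norm_tendsto_zero.1 ((tendsto_pow_sub_pow_succ hT f).mono_left hU))
  have h2 := (hlim f).sub h1
  rw [sub_zero] at h2
  refine h2.congr fun n ↦ ?_
  rw [cintegral_convPow hν]
  exact sub_sub_cancel _ _

/-- This is θ*ν = θ: ν^n integrates `convLeft hν f` to what ν^(n+1) gives on f, and both powers have
the limit θ. -/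
lemma convLeft_mul_eq_left (hU : (U : Filter ℕ) ≤ atTop)
    (hT : Tendsto (fun n ↦ convLeft hν ^ n * (1 - convLeft hν)) atTop (𝓝 0))
    (hlim : ∀ f : C₀(G, ℂ), Tendsto (fun n ↦ cintegral (convPow ν n) f) U (𝓝 (cintegral θ f))) :
    convLeft hθ * convLeft hν = convLeft hθ := by
  have key : ∀ f : C₀(G, ℂ), cintegral θ (convLeft hν f) = cintegral θ f := fun f ↦ by
    refine tendsto_nhds_unique (hlim (convLeft hν f)) ?_
    refine (tendsto_convLeft_pow_succ hν hU hT hlim f).congr fun n ↦ ?_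
    rw [cintegral_convPow hν, pow_succ]
    rfl
  ext f x
  change convLeft hθ (convLeft hν f) x = convLeft hθ f x
  rw [convLeft_apply_shift, shift_convLeft, key, convLeft_apply_shift]

/-- This is ν*θ = θ. Here ν sits on the left, so the limit is taken on the test function `convRight
hν f`, reached by Fubini. -/
lemma convLeft_mul_eq_right (hU : (U : Filter ℕ) ≤ atTop)
    (hT : Tendsto (fun n ↦ convLeft hν ^ n * (1 - convLeft hν)) atTop (𝓝 0))
    (hlim : ∀ f : C₀(G, ℂ), Tendsto (fun n ↦ cintegral (convPow ν n) f) U (𝓝 (cintegral θ f))) :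
    convLeft hν * convLeft hθ = convLeft hθ := by
  have key : ∀ f : C₀(G, ℂ), cintegral ν (convLeft hθ f) = cintegral θ f := fun f ↦ by
    rw [cintegral_convLeft hν hθ]
    refine tendsto_nhds_unique (hlim (convRight hν f)) ?_
    refine (tendsto_convLeft_pow_succ hν hU hT hlim f).congr fun n ↦ ?_
    rw [← cintegral_convLeft hν (hν.convPow n), convLeft_convPow hν, pow_succ',
      cintegral_eq_convLeft_one hν]
    rfl
  ext f x
  change convLeft hν (convLeft hθ f) x = convLeft hθ f x
  rw [convLeft_apply_shift, shift_convLeft, key, convLeft_apply_shift]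

lemma mul_pow_eq_of_mul_eq {A : Type*} [Monoid A] {S T : A} (h : S * T = S) (n : ℕ) :
    S * T ^ n = S := by
  induction n with
  | zero => simp
  | succ n ih => rw [pow_succ, ← mul_assoc, ih, h]

lemma pow_mul_eq_of_mul_eq {A : Type*} [Monoid A] {S T : A} (h : T * S = S) (n : ℕ) :
    T ^ n * S = S := by
  induction n with
  | zero => simp
  | succ n ih => rw [pow_succ, mul_assoc, h, ih]

variable {θ' : ComplexMeasure G} (hθ' : IsRegular θ') {U' : Ultrafilter ℕ}

include hν in
-- The limit of ν^n*θ' = θ' in the left factor, giving θ*θ' = θ'. With θ' = θ this is idempotence.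
lemma cintegral_convLeft_eq_of_fixed
    (hlim : ∀ f : C₀(G, ℂ), Tendsto (fun n ↦ cintegral (convPow ν n) f) U (𝓝 (cintegral θ f)))
    (hfix : convLeft hν * convLeft hθ' = convLeft hθ') (f : C₀(G, ℂ)) :
    cintegral θ (convLeft hθ' f) = cintegral θ' f := by
  refine tendsto_nhds_unique (hlim (convLeft hθ' f)) (tendsto_const_nhds.congr fun n ↦ ?_)
  rw [cintegral_convPow hν, cintegral_eq_convLeft_one hθ']
  exact congrArg (fun R : C₀(G, ℂ) →L[ℂ] C₀(G, ℂ) ↦ R f 1) (pow_mul_eq_of_mul_eq hfix n).symm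

include hν in
-- The limit of θ*ν^n = θ in the right factor along the second ultrafilter, giving θ*θ' = θ.
lemma cintegral_convLeft_eq_of_fixed'
    (hlim' : ∀ f : C₀(G, ℂ), Tendsto (fun n ↦ cintegral (convPow ν n) f) U' (𝓝 (cintegral θ' f)))
    (hfix : convLeft hθ * convLeft hν = convLeft hθ) (f : C₀(G, ℂ)) :
    cintegral θ (convLeft hθ' f) = cintegral θ f := by
  rw [cintegral_convLeft hθ hθ']
  refine tendsto_nhds_unique (hlim' (convRight hθ f)) (tendsto_const_nhds.congr fun n ↦ ?_)
  refine Eq.trans ?_ (cintegral_convLeft hθ (hν.convPow n) f)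
  refine Eq.trans ?_ (cintegral_eq_convLeft_one hθ _).symm
  refine (cintegral_eq_convLeft_one hθ f).trans ?_
  rw [convLeft_convPow hν]
  exact congrArg (fun R : C₀(G, ℂ) →L[ℂ] C₀(G, ℂ) ↦ R f 1) (mul_pow_eq_of_mul_eq hfix n).symm

end Limits

theorem exists_weakStar_limit {μ : ComplexMeasure G} (hμ : IsRegular μ) (hpb : PowerBounded μ) :
    ∃ θ : ComplexMeasure G, IsRegular θ ∧ conv θ θ = θ ∧ conv (halfMean μ) θ = θ ∧
      WeakStarTendsto (fun n ↦ convPow (halfMean μ) n) θ := by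
  obtain ⟨C, hC⟩ := hpb.exists_bound
  have hν := hμ.halfMean
  have hS : ∀ k, ‖convLeft hμ ^ k‖ ≤ C := fun k ↦ by
    have h : ‖convLeft (hμ.convPow k)‖ ≤ C := (norm_convLeft_le _).trans (hC k)
    rwa [convLeft_convPow hμ] at h
  have hT : Tendsto (fun n ↦ convLeft hν ^ n * (1 - convLeft hν)) atTop (𝓝 0) := by
    rw [convLeft_halfMean hμ]
    exact tendsto_half_smul_pow_mul (A := C₀(G, ℂ) →L[ℂ] C₀(G, ℂ)) (S := convLeft hμ) hS
  have hex := fun U : Ultrafilter ℕ ↦ exists_ultrafilter_limit U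
    (fun n ↦ convPow (halfMean μ) n) (variation_convPow_halfMean_le hμ hC)
  -- Any ultrafilter finer than `atTop` would do; the last step compares its limit with those along
  -- all others.
  obtain ⟨θ, hθ, hlim⟩ := hex (hyperfilter ℕ)
  have hU : (hyperfilter ℕ : Filter ℕ) ≤ atTop := Nat.hyperfilter_le_atTop
  have hr := convLeft_mul_eq_right hν hθ hU hT hlim
  have hl := convLeft_mul_eq_left hν hθ hU hT hlim
  refine ⟨θ, hθ, ?_, ?_, fun f ↦ (tendsto_iff_ultrafilter _ _ _).2 fun V hV ↦ ?_⟩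
  · refine ext_of_cintegral_eq (hθ.conv hθ) hθ fun f ↦ ?_
    rw [cintegral_conv hθ hθ, cintegral_convLeft_eq_of_fixed hν hθ hlim hr]
  · refine ext_of_convLeft_eq (hν.conv hθ) hθ ?_
    rw [convLeft_conv hν hθ, hr]
  · obtain ⟨θ', hθ', hlim'⟩ := hex V
    have hr' := convLeft_mul_eq_right hν hθ' hV hT hlim'
    have h : cintegral θ f = cintegral θ' f :=
      (cintegral_convLeft_eq_of_fixed' hν hθ hθ' hlim' hl f).symm.trans
        (cintegral_convLeft_eq_of_fixed hν hθ' hlim hr' f)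
    rw [h]
    exact hlim' f

end WeakStar

end MeasAlg

end

noncomputable section

namespace MeasAlg

/-! ### Left translation on L^p -/

section StronglyMeasurable

/-- The target, later L^p(G), may be nonseparable. A finite regular measure is carried by a
σ-compact set, whose image under g is separable. -/
lemma aestronglyMeasurable_of_continuous {X E : Type*} [TopologicalSpace X] [T2Space X]
    [MeasurableSpace X] [BorelSpace X] [TopologicalSpace E]
    [TopologicalSpace.PseudoMetrizableSpace E]
    (q : Measure X) [IsFiniteMeasure q] [q.Regular] {g : X → E} (hg : Continuous g) :
    AEStronglyMeasurable g q := by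
  have h : ∀ n : ℕ, ∃ K, IsCompact K ∧ q.real Kᶜ < 1 / ((n : ℝ) + 1) := fun n ↦
    exists_isCompact_measureReal_compl_lt q (by positivity)
  choose K hK hq using h
  have h1 : AEStronglyMeasurable g (q.restrict (⋃ n, K n)) := by
    rw [aestronglyMeasurable_iUnion_iff]
    exact fun n ↦ hg.continuousOn.aestronglyMeasurable_of_isCompact (hK n) (hK n).measurableSet
  rwa [Measure.restrict_eq_self_of_ae_mem] at h1
  have h2 : q.real (⋃ n, K n)ᶜ = 0 := by
    refine le_antisymm (le_of_forall_pos_le_add fun ε hε ↦ ?_) measureReal_nonneg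
    obtain ⟨n, hn⟩ := exists_nat_one_div_lt hε
    rw [zero_add]
    exact (measureReal_mono (Set.compl_subset_compl.2 (Set.subset_iUnion K n))).trans
      ((hq n).trans hn).le
  exact (measureReal_eq_zero_iff).1 h2

end StronglyMeasurable

section Translation

variable {G : Type*} [TopologicalSpace G] [Group G] [IsTopologicalGroup G] [MeasurableSpace G]
  [BorelSpace G] {m : Measure G} [m.IsMulLeftInvariant] {p : ℝ≥0∞}

lemma norm_leftTranslate (x : G) (f : Lp ℂ p m) : ‖leftTranslate x f‖ = ‖f‖ :=
  Lp.norm_compMeasurePreserving f _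

lemma leftTranslate_add (x : G) (f g : Lp ℂ p m) :
    leftTranslate x (f + g) = leftTranslate x f + leftTranslate x g :=
  map_add _ f g

lemma leftTranslate_smul (x : G) (c : ℂ) (f : Lp ℂ p m) :
    leftTranslate x (c • f) = c • leftTranslate x f :=
  map_smul (Lp.compMeasurePreservingₗ ℂ (fun s ↦ x⁻¹ * s) (measurePreserving_mul_left m x⁻¹)) c f

lemma leftTranslate_one (f : Lp ℂ p m) : leftTranslate 1 f = f := by
  refine Lp.ext ((Lp.coeFn_compMeasurePreserving f _).trans (Eventually.of_forall fun s ↦ ?_))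
  simp

lemma leftTranslate_mul (x y : G) (f : Lp ℂ p m) :
    leftTranslate (x * y) f = leftTranslate x (leftTranslate y f) := by
  refine Lp.ext ((Lp.coeFn_compMeasurePreserving f _).trans ?_)
  refine EventuallyEq.trans ?_ (Lp.coeFn_compMeasurePreserving (leftTranslate y f) _).symm
  have h := (measurePreserving_mul_left m x⁻¹).quasiMeasurePreserving.ae_eq
    (Lp.coeFn_compMeasurePreserving f (measurePreserving_mul_left m y⁻¹))
  refine EventuallyEq.trans (Eventually.of_forall fun s ↦ ?_) h.symm
  simp [mul_assoc]

variable [Fact (1 ≤ p)]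

/-- Left translation as a continuous linear map on `L^p`. -/
def leftTranslateCLM (m : Measure G) [m.IsMulLeftInvariant] (p : ℝ≥0∞) [Fact (1 ≤ p)] (x : G) :
    Lp ℂ p m →L[ℂ] Lp ℂ p m :=
  (Lp.compMeasurePreservingₗᵢ ℂ (fun s ↦ x⁻¹ * s)
    (measurePreserving_mul_left m x⁻¹)).toContinuousLinearMap

variable [LocallyCompactSpace G] [m.Regular]

lemma continuous_leftTranslate (hp : p ≠ ∞) (f : Lp ℂ p m) :
    Continuous fun x : G ↦ leftTranslate x f := by
  have hc : Continuous fun x : G ↦ (⟨fun s ↦ x⁻¹ * s, by fun_prop⟩ : C(G, G)) :=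
    (ContinuousMap.curry ⟨fun z : G × G ↦ z.1⁻¹ * z.2, by fun_prop⟩).continuous
  exact (continuous_const (y := f)).compMeasurePreservingLp hc
    (fun x ↦ measurePreserving_mul_left m x⁻¹) hp

lemma integrable_leftTranslate [T2Space G] (hp : p ≠ ∞) {ρ : ComplexMeasure G} (hρ : IsRegular ρ)
    (f : Lp ℂ p m) : Integrable (fun x : G ↦ leftTranslate x f) ρ.variation :=
  have : ρ.variation.Regular := hρ
  Integrable.of_bound (aestronglyMeasurable_of_continuous _ (continuous_leftTranslate hp f)) ‖f‖
    (Eventually.of_forall fun x ↦ (norm_leftTranslate x f).le)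

end Translation

/-! ### Coefficients of the regular representation vanish at infinity -/

section Vanishing

open scoped Pointwise

variable {G : Type*} [TopologicalSpace G] [Group G] [IsTopologicalGroup G] [MeasurableSpace G]
  [BorelSpace G] {m : Measure G} [m.IsMulLeftInvariant] {p : ℝ≥0∞}

omit [TopologicalSpace G] [Group G] [IsTopologicalGroup G] [BorelSpace G] [m.IsMulLeftInvariant] in
lemma lintegral_enorm_add_rpow_of_disjoint {u v : G → ℂ} (hu : AEStronglyMeasurable u m)
    (h : ∀ x, u x = 0 ∨ v x = 0) {r : ℝ} (hr : 0 < r) :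
    ∫⁻ x, ‖u x + v x‖ₑ ^ r ∂m = ∫⁻ x, ‖u x‖ₑ ^ r ∂m + ∫⁻ x, ‖v x‖ₑ ^ r ∂m := by
  rw [← lintegral_add_left' (hu.enorm.pow_const r)]
  refine lintegral_congr fun x ↦ ?_
  rcases h x with h | h <;> simp [h, hr]

variable [Fact (1 ≤ p)]

/-- u is a sum of n disjointly supported translates of f with unimodular factors: the p-th power of
its norm and its value under φ both grow linearly in n. -/
lemma exists_sum_of_translates (hp : p ≠ ∞) (φ : Lp ℂ p m →L[ℂ] ℂ) {f : G → ℂ}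
    (hfc : HasCompactSupport f) (hfm : MemLp f p m) {ε : ℝ} (hε : 0 < ε)
    (hfreq : ∃ᶠ x in cocompact G, ε ≤ ‖φ (leftTranslate x (hfm.toLp f))‖) (n : ℕ) :
    ∃ (u : G → ℂ) (hu : MemLp u p m), HasCompactSupport u ∧
      ∫⁻ x, ‖u x‖ₑ ^ p.toReal ∂m = n * ∫⁻ x, ‖f x‖ₑ ^ p.toReal ∂m ∧
      n * ε ≤ (φ (hu.toLp u)).re := by
  have hp0 : 0 < p.toReal :=
    ENNReal.toReal_pos (zero_lt_one.trans_le (Fact.out : 1 ≤ p)).ne' hp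
  induction n with
  | zero =>
    refine ⟨0, MemLp.zero, HasCompactSupport.zero, by simp [hp0], ?_⟩
    rw [MemLp.toLp_zero]
    simp
  | succ n ih =>
    obtain ⟨u, hu, hucs, hun, huφ⟩ := ih
    -- For x outside this compact set, the translate of f by x has support disjoint from that of u.
    have hQ : IsCompact (tsupport u * (tsupport f)⁻¹) := hucs.isCompact.mul hfc.isCompact.inv
    obtain ⟨x, hx, hxQ⟩ := (hfreq.and_eventually hQ.compl_mem_cocompact).exists
    set z := φ (leftTranslate x (hfm.toLp f)) with hz
    have hz0 : (‖z‖ : ℂ) ≠ 0 := Complex.ofReal_ne_zero.2 (hε.trans_le hx).ne'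
    -- The phase that rotates z onto the positive axis, so that the new term adds at least ε.
    set c : ℂ := (starRingEnd ℂ) z / ‖z‖ with hc
    have hcn : ‖c‖ = 1 := by
      rw [hc, norm_div, RCLike.norm_conj, Complex.norm_real, norm_norm]
      exact div_self (hε.trans_le hx).ne'
    have hcz : c * z = ‖z‖ := by
      rw [hc, div_mul_eq_mul_div, Complex.conj_mul', sq, mul_div_assoc, div_self hz0, mul_one]
    set v : G → ℂ := fun s ↦ c * f (x⁻¹ * s) with hv
    have hfx : MemLp (fun s ↦ f (x⁻¹ * s)) p m :=
      hfm.comp_measurePreserving (measurePreserving_mul_left m x⁻¹)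
    have hvm : MemLp v p m := hfx.const_mul c
    have hvcs : HasCompactSupport v :=
      (hfc.comp_homeomorph (Homeomorph.mulLeft x⁻¹)).mul_left
    have hdisj : ∀ s, u s = 0 ∨ v s = 0 := fun s ↦ by
      by_contra! h
      refine hxQ ⟨s, subset_tsupport _ h.1, (x⁻¹ * s)⁻¹, ?_, by simp⟩
      exact Set.inv_mem_inv.2 (subset_tsupport _ (right_ne_zero_of_mul h.2))
    refine ⟨u + v, hu.add hvm, hucs.add hvcs, ?_, ?_⟩
    · have h1 : ∫⁻ s, ‖v s‖ₑ ^ p.toReal ∂m = ∫⁻ s, ‖f s‖ₑ ^ p.toReal ∂m := by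
        rw [← lintegral_mul_left_eq_self (fun s ↦ ‖f s‖ₑ ^ p.toReal) x⁻¹]
        refine lintegral_congr fun s ↦ ?_
        rw [hv, enorm_mul, ← ofReal_norm, hcn, ENNReal.ofReal_one, one_mul]
      refine (lintegral_enorm_add_rpow_of_disjoint hu.1 hdisj hp0).trans ?_
      rw [hun, h1]
      push_cast
      ring
    · have h1 : hvm.toLp v = c • leftTranslate x (hfm.toLp f) := rfl
      rw [MemLp.toLp_add hu hvm, map_add, h1, map_smul, smul_eq_mul, ← hz, hcz, Complex.add_re,
        Complex.ofReal_re]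
      push_cast
      linarith

/-- Otherwise sums of n disjoint translates would give nε ≤ ‖φ‖ ‖f‖ n^(1/p) for all n, which is
impossible for p > 1. -/
lemma tendsto_leftTranslate_of_hasCompactSupport (hp1 : 1 < p) (hp : p ≠ ∞)
    (φ : Lp ℂ p m →L[ℂ] ℂ) {f : G → ℂ} (hfc : HasCompactSupport f)
    (hfm : MemLp f p m) :
    Tendsto (fun x ↦ φ (leftTranslate x (hfm.toLp f))) (cocompact G) (𝓝 0) := by
  rw [Metric.tendsto_nhds]
  intro ε hε
  by_contra hnot
  have hfreq : ∃ᶠ x in cocompact G, ε ≤ ‖φ (leftTranslate x (hfm.toLp f))‖ := by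
    simpa [Filter.not_eventually] using hnot
  have hp0 : p ≠ 0 := (zero_lt_one.trans hp1).ne'
  have hr1 : 1 < p.toReal := by
    rw [← ENNReal.toReal_one]
    exact (ENNReal.toReal_lt_toReal ENNReal.one_ne_top hp).2 hp1
  have hnorm : ∀ {u : G → ℂ} (hu : MemLp u p m),
      ‖hu.toLp u‖ = (∫⁻ x, ‖u x‖ₑ ^ p.toReal ∂m).toReal ^ (1 / p.toReal) := fun hu ↦ by
    rw [Lp.norm_toLp, eLpNorm_eq_lintegral_rpow_enorm_toReal hp0 hp, ENNReal.toReal_rpow]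
  have hbound : ∀ n : ℕ, n * ε ≤ (‖φ‖ * ‖hfm.toLp f‖) * (n : ℝ) ^ (1 / p.toReal) := fun n ↦ by
    obtain ⟨u, hu, -, hun, huφ⟩ := exists_sum_of_translates hp φ hfc hfm hε hfreq n
    calc n * ε ≤ ‖φ (hu.toLp u)‖ := huφ.trans (Complex.re_le_norm _)
      _ ≤ ‖φ‖ * ‖hu.toLp u‖ := φ.le_opNorm _
      _ = _ := by
        rw [hnorm hu, hnorm hfm, hun, ENNReal.toReal_mul, ENNReal.toReal_natCast,
          Real.mul_rpow (Nat.cast_nonneg n) ENNReal.toReal_nonneg]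
        ring
  have hs : 0 < 1 - 1 / p.toReal := by
    rw [sub_pos, div_lt_one (zero_lt_one.trans hr1)]
    exact hr1
  obtain ⟨n, hn, hn0⟩ := ((((tendsto_rpow_atTop hs).comp tendsto_natCast_atTop_atTop).eventually
    (eventually_gt_atTop (‖φ‖ * ‖hfm.toLp f‖ / ε))).and (eventually_gt_atTop 0)).exists
  have hn0' : (0 : ℝ) < n := Nat.cast_pos.2 hn0
  have h1 : (n : ℝ) ^ (1 - 1 / p.toReal) * (n : ℝ) ^ (1 / p.toReal) = n := by
    rw [← Real.rpow_add hn0', sub_add_cancel, Real.rpow_one]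
  have h2 := mul_lt_mul_of_pos_right ((div_lt_iff₀ hε).1 hn)
    (Real.rpow_pos_of_pos hn0' (1 / p.toReal))
  have h3 := hbound n
  simp only [Function.comp_apply] at h2
  rw [mul_right_comm ((n : ℝ) ^ _), h1] at h2
  exact absurd h3 (not_le.2 h2)

omit [Group G] [IsTopologicalGroup G] [m.IsMulLeftInvariant] [Fact (1 ≤ p)] in
lemma exists_hasCompactSupport_eLpNorm_sub_le [T2Space G] [m.Regular] (hp : p ≠ ∞) {f : G → ℂ}
    (hf : MemLp f p m) {ε : ℝ≥0∞} (hε : ε ≠ 0) :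
    ∃ g : G → ℂ, eLpNorm (f - g) p m ≤ ε ∧ HasCompactSupport g ∧ MemLp g p m := by
  refine hf.induction_dense hp (fun g ↦ HasCompactSupport g ∧ MemLp g p m) ?_ ?_
    (fun f hf ↦ hf.2.aestronglyMeasurable) hε
  swap
  · rintro f g ⟨hf, hfm⟩ ⟨hg, hgm⟩
    exact ⟨HasCompactSupport.add hf hg, MemLp.add hfm hgm⟩
  intro c t ht htm ε hε
  obtain ⟨η, hη0, hη⟩ := exists_eLpNorm_indicator_le (μ := m) hp c hε
  obtain ⟨s, hst, hs, hlt⟩ := ht.exists_isCompact_sdiff_lt htm.ne (ε := η) (by simpa using hη0.ne')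
  refine ⟨s.indicator fun _ ↦ c, ?_, HasCompactSupport.intro hs fun x hx ↦
    Set.indicator_of_notMem hx _,
    memLp_indicator_const p hs.measurableSet c (Or.inr hs.measure_ne_top)⟩
  rw [← eLpNorm_neg, neg_sub, ← Set.indicator_sdiff hst]
  exact hη _ hlt.le

variable [T2Space G] [m.Regular]

/-- The coefficients of the left regular representation on `L^p`, `1 < p < ∞`, vanish at
infinity. -/
theorem tendsto_leftTranslate (hp1 : 1 < p) (hp : p ≠ ∞) (φ : Lp ℂ p m →L[ℂ] ℂ) (f : Lp ℂ p m) :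
    Tendsto (fun x ↦ φ (leftTranslate x f)) (cocompact G) (𝓝 0) := by
  rw [Metric.tendsto_nhds]
  intro ε hε
  set η := ε / (2 * (‖φ‖ + 1)) with hη
  have hη0 : 0 < η := by positivity
  obtain ⟨g, hfg, hgc, hgm⟩ := exists_hasCompactSupport_eLpNorm_sub_le hp (Lp.memLp f)
    (ε := ENNReal.ofReal η) (by simpa using hη0)
  have h1 : ‖f - hgm.toLp g‖ ≤ η := by
    have h2 : f - hgm.toLp g = ((Lp.memLp f).sub hgm).toLp _ := by
      rw [MemLp.toLp_sub (Lp.memLp f) hgm, Lp.toLp_coeFn]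
    rw [h2, Lp.norm_toLp]
    exact ENNReal.toReal_le_of_le_ofReal hη0.le hfg
  filter_upwards [Metric.tendsto_nhds.1
    (tendsto_leftTranslate_of_hasCompactSupport hp1 hp φ hgc hgm) (ε / 2) (half_pos hε)]
    with x hx
  rw [dist_zero_right] at hx ⊢
  have h3 : φ (leftTranslate x f) =
      φ (leftTranslate x (f - hgm.toLp g)) + φ (leftTranslate x (hgm.toLp g)) := by
    rw [← map_add, ← leftTranslate_add, sub_add_cancel]
  have h4 : ‖φ (leftTranslate x (f - hgm.toLp g))‖ ≤ ε / 2 := by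
    refine (φ.le_opNorm _).trans ?_
    rw [norm_leftTranslate]
    calc ‖φ‖ * ‖f - hgm.toLp g‖ ≤ (‖φ‖ + 1) * η := by gcongr; linarith
      _ = ε / 2 := by rw [hη]; field_simp
  rw [h3]
  exact (norm_add_le _ _).trans_lt (by linarith)

variable [LocallyCompactSpace G]

/-- The coefficient `x ↦ φ (π(x) f)` as an element of `C₀(G)`. -/
def coefficient (hp1 : 1 < p) (hp : p ≠ ∞) (φ : Lp ℂ p m →L[ℂ] ℂ) (f : Lp ℂ p m) : C₀(G, ℂ) :=
  ⟨⟨fun x ↦ φ (leftTranslate x f), φ.continuous.comp (continuous_leftTranslate hp f)⟩,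
    tendsto_leftTranslate hp1 hp φ f⟩

/-- This turns weak* convergence of measures into weak convergence in L^p. -/
lemma apply_convLp (hp1 : 1 < p) (hp : p ≠ ∞) (φ : Lp ℂ p m →L[ℂ] ℂ) (f : Lp ℂ p m)
    {ρ : ComplexMeasure G} (hρ : IsRegular ρ) :
    φ (convLp ρ f) = cintegral ρ (coefficient hp1 hp φ f) :=
  clm_cintegral φ (integrable_leftTranslate hp hρ f)

end Vanishing

/-! ### Convolution operators on L^p and norm convergence -/

section Operators

variable {G : Type*} [TopologicalSpace G] [Group G] [IsTopologicalGroup G] [MeasurableSpace G]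
  [BorelSpace G] [T2Space G] [LocallyCompactSpace G] {m : Measure G} [m.IsMulLeftInvariant]
  [m.Regular] {p : ℝ≥0∞} [Fact (1 ≤ p)]

omit [T2Space G] [LocallyCompactSpace G] [m.Regular] in
lemma norm_convLp_le (ρ : ComplexMeasure G) (f : Lp ℂ p m) :
    ‖convLp ρ f‖ ≤ ρ.variation.real Set.univ * ‖f‖ := by
  rw [mul_comm]
  exact norm_cintegral_le ρ fun x ↦ (norm_leftTranslate x f).le

/-- The operator `f ↦ ρ * f` on `L^p`. -/
def convLpCLM (m : Measure G) [m.IsMulLeftInvariant] [m.Regular] (hp : p ≠ ∞)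
    {ρ : ComplexMeasure G} (hρ : IsRegular ρ) : Lp ℂ p m →L[ℂ] Lp ℂ p m :=
  LinearMap.mkContinuous
    { toFun := convLp ρ
      map_add' := fun f g ↦ by
        rw [convLp, convLp, convLp, ← cintegral_add (integrable_leftTranslate hp hρ f)
          (integrable_leftTranslate hp hρ g)]
        simp only [leftTranslate_add]
      map_smul' := fun c f ↦ by
        rw [convLp, convLp, RingHom.id_apply, ← cintegral_smul c (integrable_leftTranslate hp hρ f)]
        simp only [leftTranslate_smul] }
    (ρ.variation.real Set.univ) (norm_convLp_le ρ)

lemma convLpCLM_apply (hp : p ≠ ∞) {ρ : ComplexMeasure G} (hρ : IsRegular ρ) (f : Lp ℂ p m) :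
    convLpCLM m hp hρ f = convLp ρ f := rfl

lemma norm_convLpCLM_le (hp : p ≠ ∞) {ρ : ComplexMeasure G} (hρ : IsRegular ρ) :
    ‖convLpCLM m hp hρ‖ ≤ ρ.variation.real Set.univ :=
  LinearMap.mkContinuous_norm_le _ measureReal_nonneg _

lemma eq_of_forall_clm {E : Type*} [NormedAddCommGroup E] [NormedSpace ℂ E] {f g : E}
    (h : ∀ φ : E →L[ℂ] ℂ, φ f = φ g) : f = g := by
  by_contra hne
  obtain ⟨φ, -, hφ⟩ := exists_dual_vector ℂ (f - g) (norm_ne_zero_iff.2 (sub_ne_zero.2 hne))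
  rw [map_sub, h φ, sub_self] at hφ
  exact norm_ne_zero_iff.2 (sub_ne_zero.2 hne) (Complex.ofReal_eq_zero.1 hφ.symm)

lemma leftTranslate_convLp (hp : p ≠ ∞) {ρ : ComplexMeasure G} (hρ : IsRegular ρ) (x : G)
    (f : Lp ℂ p m) :
    leftTranslate x (convLp ρ f) = cintegral ρ fun y ↦ leftTranslate (x * y) f := by
  simp only [leftTranslate_mul]
  exact clm_cintegral (leftTranslateCLM m p x) (integrable_leftTranslate hp hρ f)

/-- Tested against a functional, this is the defining identity of `conv` applied to a coefficient,
which is an admissible test function because it lies in C₀(G). -/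
lemma convLp_conv (hp1 : 1 < p) (hp : p ≠ ∞) {μ ν : ComplexMeasure G} (hμ : IsRegular μ)
    (hν : IsRegular ν) (f : Lp ℂ p m) : convLp (conv μ ν) f = convLp μ (convLp ν f) := by
  refine eq_of_forall_clm fun φ ↦ ?_
  rw [apply_convLp hp1 hp φ f (hμ.conv hν), apply_convLp hp1 hp φ _ hμ, (isConv_conv hμ hν).2]
  refine congrArg (cintegral μ) (funext fun x ↦ ?_)
  change _ = φ (leftTranslate x (convLp ν f))
  rw [leftTranslate_convLp hp hν]
  refine (clm_cintegral φ ?_).symm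
  simp only [leftTranslate_mul]
  exact (leftTranslateCLM m p x).integrable_comp (integrable_leftTranslate hp hν f)

omit [LocallyCompactSpace G] [m.Regular] in
lemma convLp_deltaOne (f : Lp ℂ p m) : convLp (deltaOne G) f = f :=
  (cintegral_dirac 1 _).trans (leftTranslate_one f)

lemma convLpCLM_conv (hp1 : 1 < p) (hp : p ≠ ∞) {μ ν : ComplexMeasure G} (hμ : IsRegular μ)
    (hν : IsRegular ν) :
    convLpCLM m hp (hμ.conv hν) = convLpCLM m hp hμ * convLpCLM m hp hν :=
  ContinuousLinearMap.ext fun f ↦ convLp_conv hp1 hp hμ hν f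

lemma convLpCLM_deltaOne (hp : p ≠ ∞) : convLpCLM m hp (isRegular_deltaOne (G := G)) = 1 :=
  ContinuousLinearMap.ext convLp_deltaOne

lemma convLpCLM_convPow (hp1 : 1 < p) (hp : p ≠ ∞) {μ : ComplexMeasure G} (hμ : IsRegular μ) :
    ∀ n, convLpCLM m hp (hμ.convPow n) = convLpCLM m hp hμ ^ n
  | 0 => convLpCLM_deltaOne hp
  | n + 1 => by
    rw [pow_succ', ← convLpCLM_convPow hp1 hp hμ n]
    exact convLpCLM_conv hp1 hp hμ (hμ.convPow n)

lemma convLpCLM_halfMean (hp : p ≠ ∞) {μ : ComplexMeasure G} (hμ : IsRegular μ) :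
    convLpCLM m hp hμ.halfMean = (1 / 2 : ℂ) • (1 + convLpCLM m hp hμ) := by
  refine ContinuousLinearMap.ext fun f ↦ ?_
  have h1 := integrable_leftTranslate hp isRegular_deltaOne f
  have h2 := integrable_leftTranslate hp hμ f
  refine (cintegral_smul_measure (1 / 2 : ℂ) (integrable_variation_add h1 h2)).trans ?_
  rw [cintegral_add_measure h1 h2]
  change (1 / 2 : ℂ) • (convLp (deltaOne G) f + convLp μ f) = _
  rw [convLp_deltaOne]
  rfl

theorem tendsto_convLp_halfMean {μ θ : ComplexMeasure G} (hμ : IsRegular μ)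
    (hpb : PowerBounded μ) (hθ : IsRegular θ) (hfix : conv (halfMean μ) θ = θ)
    (hlim : WeakStarTendsto (fun n ↦ convPow (halfMean μ) n) θ) (hp1 : 1 < p) (hp : p ≠ ∞)
    (f : Lp ℂ p m) :
    Tendsto (fun n ↦ convLp (convPow (halfMean μ) n) f) atTop (𝓝 (convLp θ f)) := by
  obtain ⟨C, hC⟩ := hpb.exists_bound
  have hS : ∀ k, ‖convLpCLM m hp hμ ^ k‖ ≤ C := fun k ↦ by
    rw [← convLpCLM_convPow hp1]
    exact (norm_convLpCLM_le hp _).trans (hC k)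
  have hpow : ∀ n, (convLpCLM m hp hμ.halfMean ^ n) f = convLp (convPow (halfMean μ) n) f :=
    fun n ↦ by rw [← convLpCLM_convPow hp1, convLpCLM_apply]
  have key : Tendsto (fun n ↦ (convLpCLM m hp hμ.halfMean ^ n) f) atTop (𝓝 (convLp θ f)) := by
    refine tendsto_pow_of_weak (C := C) ?_ ?_ ?_ fun φ ↦ ?_
    · rw [convLpCLM_halfMean hp hμ]
      exact norm_half_smul_pow_le hS
    · rw [convLpCLM_halfMean hp hμ]
      exact tendsto_half_smul_pow_mul hS
    · rw [convLpCLM_apply, ← convLp_conv hp1 hp hμ.halfMean hθ, hfix]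
    · rw [apply_convLp hp1 hp φ f hθ]
      refine (hlim (coefficient hp1 hp φ f)).congr fun n ↦ ?_
      rw [hpow, apply_convLp hp1 hp φ f (hμ.halfMean.convPow n)]
  exact key.congr hpow

end Operators

end MeasAlg

end

theorem corollary3p2 {G : Type*} [TopologicalSpace G] [Group G] [IsTopologicalGroup G]
    [LocallyCompactSpace G] [T2Space G] [MeasurableSpace G] [BorelSpace G]
    (m : Measure G) [m.IsHaarMeasure] [m.Regular]
    (μ : ComplexMeasure G) (hμ : MeasAlg.IsRegular μ) (hpb : MeasAlg.PowerBounded μ) :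
    ∃ θ : ComplexMeasure G, MeasAlg.IsRegular θ ∧ MeasAlg.conv θ θ = θ ∧
      MeasAlg.WeakStarTendsto
        (fun n ↦ MeasAlg.convPow ((1 / 2 : ℂ) • (MeasAlg.deltaOne G + μ)) n) θ ∧
      ∀ (p : ℝ≥0∞) [Fact (1 ≤ p)], 1 < p → p < ∞ → ∀ f : Lp ℂ p m,
        Tendsto
          (fun n ↦ MeasAlg.convLp (MeasAlg.convPow ((1 / 2 : ℂ) • (MeasAlg.deltaOne G + μ)) n) f)
          atTop (𝓝 (MeasAlg.convLp θ f)) := by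
  obtain ⟨θ, hθ, hidem, hfix, hlim⟩ := MeasAlg.exists_weakStar_limit hμ hpb
  -- `halfMean μ` unfolds to the measure of the statement; `hfix` makes θ*f a fixed vector, as the
  -- ergodic argument requires.
  exact ⟨θ, hθ, hidem, hlim, fun p _ hp1 hp f ↦
    MeasAlg.tendsto_convLp_halfMean hμ hpb hθ hfix hlim hp1 hp.ne f⟩
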